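/- Let $n\ge 1$ and let $I=\{1,\dots,n,\overline n,\dots,\overline 1\}$, ordered by $1\prec 2\prec\dots\prec n\prec\overline n\prec\dots\prec\overline 2\prec\overline 1$. Let $\mathcal Z$ be the commutative ring (over $\mathbb Z$) generated by $z_{x,a}$ ($x\in I$, $a\in\mathbb C$) with the relations $$z_{i,a}\,z_{\overline i,\,a-2n+2i-4}=z_{i-1,a}\,z_{\overline{i-1},\,a-2n+2i-4}\qquad(1\le i\le n,\ a\in\mathbb C),$$ where $z_{0,a}=z_{\overline 0,a}=1$. Let $\mathcal A$ be the ring of formal power series in $X$ with coefficients in $\mathcal Z$ (written on the left) and with the commutation rule $X z_{x,a}=z_{x,a-2}X$. Define $e_{i,a},h_{i,a}\in\mathcal Z$ by $$\sum_{i\ge 0}e_{i,a}X^i=(1+z_{1,a}X)\cdots(1+z_{n,a}X)\,(1-z_{n,a}Xz_{\overline n,a}X)\,(1+z_{\overline n,a}X)\cdots(1+z_{\overline 1,a}X),$$ $$\sum_{i\ge 0}h_{i,a}X^i=(1-z_{\overline 1,a}X)^{-1}\cdots(1-z_{\overline n,a}X)^{-1}(1-z_{n,a}Xz_{\overline n,a}X)^{-1}(1-z_{n,a}X)^{-1}\cdots(1-z_{1,a}X)^{-1},$$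 and $e_{i,a}=h_{i,a}=0$ for $i<0$. For partitions $\mu\subset\lambda$, with conjugates $\mu',\lambda'$ and with $l(\cdot)$ the number of non-zero parts, the Jacobi–Trudi determinant of type $C_n$ is $$\chi_{\lambda/\mu,a}=\det\bigl(h_{\lambda_i-\mu_j-i+j,\;a+2(\lambda_i-i)}\bigr)_{1\le i,j\le l}=\det\bigl(e_{\lambda'_i-\mu'_j-i+j,\;a-2(\mu'_j-j+1)}\bigr)_{1\le i,j\le l'},$$ where $l\ge l(\lambda),l(\mu)$ and $l'\ge l(\lambda'),l(\mu')$ are arbitrary. A tableau $T$ of shape $\lambda/\mu$ is a filling of the boxes $(i,j)$ (row $i$, column $j$) of $\lambda/\mu$ by letters $T(i,j)\in I$; put $z^T_a=\prod_{(i,j)\in\lambda/\mu}z_{T(i,j),\,a+2(j-i)}$. For $\lambda/\mu$ of one column, let $\mathrm{Tab}(C_n,\lambda/\mu)$ be the set of tableaux whose entries strictly increase (for $\prec$) down the column and which satisfy (E-1C): if $l\ge 2$ vertically consecutive entries $c_1,\dots,c_l$ (from top to bottom) of $T$ satisfy $c_1=c$ and $c_l=\overline c$ for some $1\le c\le n$,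 then $l-1\le n-c$. **Theorem.** Let $\lambda/\mu$ be a skew diagram with $l(\lambda')=1$ and $l(\lambda)\le n+1$, and let $a\in\mathbb C$. Then $$\chi_{\lambda/\mu,a}=\sum_{T\in\mathrm{Tab}(C_n,\lambda/\mu)}z^T_a .$$ That is, for all admissible $l$ and $l'$, each of the two determinants above equals this sum. -/

import Mathlib

open scoped BigOperators

noncomputable section

/-! ## Skew power series

`SkewSeries σ` is the ring of formal series `∑ fₘ Xᵐ` with coefficients in `R` written on the left
and with the commutation rule `X r = σ(r) X`. -/

/-- Formal series `∑ₘ (coeff m) Xᵐ` over `R`, to be multiplied with the rule `X r = σ(r) X`. -/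
@[ext]
structure SkewSeries {R : Type*} [CommRing R] (σ : R →+* R) where
  coeff : ℕ → R

namespace SkewSeries

variable {R : Type*} [CommRing R] {σ : R →+* R}

instance : Zero (SkewSeries σ) := ⟨⟨fun _ => 0⟩⟩
instance : One (SkewSeries σ) := ⟨⟨fun m => if m = 0 then 1 else 0⟩⟩
instance : Add (SkewSeries σ) := ⟨fun f g => ⟨fun m => f.coeff m + g.coeff m⟩⟩
instance : Neg (SkewSeries σ) := ⟨fun f => ⟨fun m => -f.coeff m⟩⟩

/-- `(∑ fᵢ Xⁱ)(∑ gⱼ Xʲ) = ∑ fᵢ σⁱ(gⱼ) Xⁱ⁺ʲ`. -/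
instance : Mul (SkewSeries σ) :=
  ⟨fun f g => ⟨fun m =>
    ∑ p ∈ Finset.HasAntidiagonal.antidiagonal m, f.coeff p.1 * (σ ^ p.1) (g.coeff p.2)⟩⟩

@[simp] theorem coeff_zero' (m : ℕ) : (0 : SkewSeries σ).coeff m = 0 := rfl
theorem coeff_one (m : ℕ) : (1 : SkewSeries σ).coeff m = if m = 0 then 1 else 0 := rfl
@[simp] theorem coeff_add (f g : SkewSeries σ) (m : ℕ) :
    (f + g).coeff m = f.coeff m + g.coeff m := rfl
@[simp] theorem coeff_neg (f : SkewSeries σ) (m : ℕ) : (-f).coeff m = -f.coeff m := rfl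
theorem coeff_mul (f g : SkewSeries σ) (m : ℕ) :
    (f * g).coeff m =
      ∑ p ∈ Finset.HasAntidiagonal.antidiagonal m, f.coeff p.1 * (σ ^ p.1) (g.coeff p.2) := rfl

instance : Ring (SkewSeries σ) where
  add_assoc f g h := by ext m; simp [add_assoc]
  zero_add f := by ext m; simp
  add_zero f := by ext m; simp
  add_comm f g := by ext m; simp [add_comm]
  neg_add_cancel f := by ext m; simp
  nsmul := nsmulRec
  zsmul := zsmulRec
  zero_mul f := by ext m; simp [coeff_mul]
  mul_zero f := by ext m; simp [coeff_mul]
  left_distrib f g h := by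
    ext m; simp [coeff_mul, mul_add, Finset.sum_add_distrib]
  right_distrib f g h := by
    ext m; simp [coeff_mul, add_mul, Finset.sum_add_distrib]
  one_mul f := by
    ext m
    rw [coeff_mul, Finset.sum_eq_single (0, m)]
    · simp [coeff_one]
    · rintro ⟨i, j⟩ hij hne
      have hi : i ≠ 0 := by
        rintro rfl
        simp at hij
        exact hne (by simp [hij])
      simp [coeff_one, hi]
    · intro h; simp at h
  mul_one f := by
    ext m
    rw [coeff_mul, Finset.sum_eq_single (m, 0)]
    · simp [coeff_one]
    · rintro ⟨i, j⟩ hij hne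
      have hj : j ≠ 0 := by
        rintro rfl
        simp at hij
        exact hne (by simp [hij])
      simp [coeff_one, hj]
    · intro h; simp at h
  mul_assoc f g h := by
    ext m
    simp only [coeff_mul, Finset.sum_mul, Finset.mul_sum, map_sum, map_mul]
    rw [Finset.sum_sigma', Finset.sum_sigma']
    refine Finset.sum_nbij' (fun x => ⟨(x.2.1, x.2.2 + x.1.2), (x.2.2, x.1.2)⟩)
      (fun x => ⟨(x.1.1 + x.2.1, x.2.2), (x.1.1, x.2.1)⟩) ?_ ?_ ?_ ?_ ?_
    · rintro ⟨⟨a, b⟩, ⟨c, d⟩⟩ hx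
      simp at hx ⊢
      omega
    · rintro ⟨⟨a, b⟩, ⟨c, d⟩⟩ hx
      simp at hx ⊢
      omega
    · rintro ⟨⟨a, b⟩, ⟨c, d⟩⟩ hx
      simp at hx ⊢
      exact hx.2
    · rintro ⟨⟨a, b⟩, ⟨c, d⟩⟩ hx
      simp at hx ⊢
      exact hx.2
    · rintro ⟨⟨a, b⟩, ⟨c, d⟩⟩ hx
      simp only [Finset.mem_sigma, Finset.HasAntidiagonal.mem_antidiagonal] at hx
      obtain ⟨-, rfl⟩ := hx
      simp only [pow_add, RingHom.coe_mul, Function.comp_apply, mul_assoc]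

/-- The constant series `r`. -/
def C (r : R) : SkewSeries σ := ⟨fun m => if m = 0 then r else 0⟩

/-- The variable `X`. -/
def X : SkewSeries σ := ⟨fun m => if m = 1 then 1 else 0⟩

/-- The commutation rule `X r = σ(r) X`. -/
theorem X_mul_C (r : R) : (X * C r : SkewSeries σ) = C (σ r) * X := by
  ext m
  rw [coeff_mul, coeff_mul]
  rcases m with _ | _ | m
  · simp [C, X]
  · simp [C, X, Finset.Nat.antidiagonal_succ]
  · rw [Finset.sum_eq_zero, Finset.sum_eq_zero]
    · rintro ⟨i, j⟩ hij
      simp only [Finset.HasAntidiagonal.mem_antidiagonal] at hij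
      by_cases hi : i = 0 <;> by_cases hj : j = 1 <;> simp [C, X, hi, hj] <;> omega
    · rintro ⟨i, j⟩ hij
      simp only [Finset.HasAntidiagonal.mem_antidiagonal] at hij
      by_cases hi : i = 1 <;> by_cases hj : j = 0 <;> simp [C, X, hi, hj] <;> omega

theorem coeff_pow_eq_zero {f : SkewSeries σ} (hf : f.coeff 0 = 0) :
    ∀ (k m : ℕ), m < k → (f ^ k).coeff m = 0
  | 0, m, h => by omega
  | k + 1, m, h => by
    rw [pow_succ, coeff_mul]
    refine Finset.sum_eq_zero ?_
    rintro ⟨i, j⟩ hij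
    simp only [Finset.HasAntidiagonal.mem_antidiagonal] at hij
    rcases Nat.eq_zero_or_pos j with rfl | hj
    · simp [hf]
    · simp [coeff_pow_eq_zero hf k i (by omega)]

/-- The geometric series `∑ₖ fᵏ`; meaningful when `f` has no constant term, in which case only
`k ≤ m` contribute to the coefficient of `Xᵐ`. It is the inverse of `1 - f`. -/
def geom (f : SkewSeries σ) : SkewSeries σ :=
  ⟨fun m => (∑ k ∈ Finset.range (m + 1), f ^ k).coeff m⟩

theorem coeff_sum {ι : Type*} (s : Finset ι) (F : ι → SkewSeries σ) (m : ℕ) :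
    (∑ k ∈ s, F k).coeff m = ∑ k ∈ s, (F k).coeff m := by
  classical
  induction s using Finset.induction_on with
  | empty => simp
  | insert a s ha ih => simp [Finset.sum_insert ha, ih]

theorem coeff_geom {f : SkewSeries σ} (hf : f.coeff 0 = 0) {m N : ℕ} (h : m ≤ N) :
    (geom f).coeff m = (∑ k ∈ Finset.range (N + 1), f ^ k).coeff m := by
  rw [geom, coeff_sum, coeff_sum]
  refine Finset.sum_subset (Finset.range_mono (by omega)) ?_
  intro k _ hk
  simp only [Finset.mem_range, not_lt] at hk
  exact coeff_pow_eq_zero hf k m (by omega)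

theorem one_sub_mul_geom {f : SkewSeries σ} (hf : f.coeff 0 = 0) : (1 - f) * geom f = 1 := by
  ext m
  have h1 : ((1 - f) * geom f).coeff m
      = ((1 - f) * ∑ k ∈ Finset.range (m + 1), f ^ k).coeff m := by
    rw [coeff_mul, coeff_mul]
    refine Finset.sum_congr rfl ?_
    rintro ⟨i, j⟩ hij
    simp only [Finset.HasAntidiagonal.mem_antidiagonal] at hij
    rw [coeff_geom hf (show j ≤ m by omega)]
  rw [h1, mul_neg_geom_sum, sub_eq_add_neg, coeff_add, coeff_neg,
    coeff_pow_eq_zero hf (m + 1) m (by omega)]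
  simp

theorem geom_mul_one_sub {f : SkewSeries σ} (hf : f.coeff 0 = 0) : geom f * (1 - f) = 1 := by
  ext m
  have h1 : (geom f * (1 - f)).coeff m
      = ((∑ k ∈ Finset.range (m + 1), f ^ k) * (1 - f)).coeff m := by
    rw [coeff_mul, coeff_mul]
    refine Finset.sum_congr rfl ?_
    rintro ⟨i, j⟩ hij
    simp only [Finset.HasAntidiagonal.mem_antidiagonal] at hij
    rw [coeff_geom hf (show i ≤ m by omega)]
  rw [h1, geom_sum_mul_neg, sub_eq_add_neg, coeff_add, coeff_neg,
    coeff_pow_eq_zero hf (m + 1) m (by omega)]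
  simp

end SkewSeries

namespace TypeC

/-! ## Letters and the coefficient ring -/

/-- The letters `1, …, n, n̄, …, 1̄`: the letter `i + 1` is `pos i`, and its bar is `bar i`. -/
inductive Letter (n : ℕ) : Type
  | pos (i : Fin n) : Letter n
  | bar (i : Fin n) : Letter n
  deriving DecidableEq, Fintype

namespace Letter

/-- The position of a letter in the sequence `1, 2, …, n, n̄, …, 2̄, 1̄` (counted from `1`). -/
def rank {n : ℕ} : Letter n → ℕ
  | pos i => i + 1
  | bar i => 2 * n - i

/-- The total order `1 ≺ 2 ≺ ⋯ ≺ n ≺ n̄ ≺ ⋯ ≺ 2̄ ≺ 1̄`. -/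
instance {n : ℕ} : LinearOrder (Letter n) :=
  LinearOrder.lift' rank (by
    rintro (⟨i, hi⟩ | ⟨i, hi⟩) (⟨j, hj⟩ | ⟨j, hj⟩) h <;> simp [rank] at h ⊢ <;> omega)

/-- `x` is the letter `n`. -/
def IsN {n : ℕ} (x : Letter n) : Prop := ∃ k : Fin n, (k : ℕ) + 1 = n ∧ x = pos k

/-- `x` is the letter `n̄`. -/
def IsNBar {n : ℕ} (x : Letter n) : Prop := ∃ k : Fin n, (k : ℕ) + 1 = n ∧ x = bar k

end Letter

/-- The polynomial ring on the free variables `z_{x,a}`. -/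
abbrev FreeZ (n : ℕ) : Type := MvPolynomial (Letter n × ℂ) ℤ

/-- The variable `z_{i,a}` for `1 ≤ i ≤ n`, with `z_{0,a} = 1`. -/
def freePos (n : ℕ) : ℕ → ℂ → FreeZ n
  | 0, _ => 1
  | i + 1, a => if h : i < n then MvPolynomial.X (Letter.pos ⟨i, h⟩, a) else 1

/-- The variable `z_{ī,a}` for `1 ≤ i ≤ n`, with `z_{0̄,a} = 1`. -/
def freeBar (n : ℕ) : ℕ → ℂ → FreeZ n
  | 0, _ => 1
  | i + 1, a => if h : i < n then MvPolynomial.X (Letter.bar ⟨i, h⟩, a) else 1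

/-- The difference of the two sides of
`z_{i,a} z_{ī,a-2n+2i-4} = z_{i-1,a} z_{\overline{i-1},a-2n+2i-4}`. -/
def relator (n i : ℕ) (a : ℂ) : FreeZ n :=
  freePos n i a * freeBar n i (a - 2 * n + 2 * i - 4)
    - freePos n (i - 1) a * freeBar n (i - 1) (a - 2 * n + 2 * i - 4)

/-- The ideal of relations, `i = 1, …, n` and `a ∈ ℂ`. -/
def relIdeal (n : ℕ) : Ideal (FreeZ n) :=
  Ideal.span {r | ∃ (i : ℕ) (a : ℂ), 1 ≤ i ∧ i ≤ n ∧ r = relator n i a}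

/-- The ring `𝒵` of type `C_n`. -/
abbrev ZRing (n : ℕ) : Type := FreeZ n ⧸ relIdeal n

/-- The generator `z_{x,a}` of `𝒵`. -/
def z {n : ℕ} (x : Letter n) (a : ℂ) : ZRing n :=
  Ideal.Quotient.mk (relIdeal n) (MvPolynomial.X (x, a))

/-- The shift `z_{x,a} ↦ z_{x,a-2}` on polynomials. -/
def freeShift (n : ℕ) : FreeZ n →+* FreeZ n :=
  (MvPolynomial.rename (fun p : Letter n × ℂ => (p.1, p.2 - 2))).toRingHom

theorem freeShift_X (n : ℕ) (x : Letter n) (a : ℂ) :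
    freeShift n (MvPolynomial.X (x, a)) = MvPolynomial.X (x, a - 2) := by
  simp [freeShift]

theorem freeShift_freePos (n i : ℕ) (a : ℂ) :
    freeShift n (freePos n i a) = freePos n i (a - 2) := by
  rcases i with _ | i
  · simp [freePos]
  · by_cases h : i < n <;> simp [freePos, h, freeShift_X]

theorem freeShift_freeBar (n i : ℕ) (a : ℂ) :
    freeShift n (freeBar n i a) = freeBar n i (a - 2) := by
  rcases i with _ | i
  · simp [freeBar]
  · by_cases h : i < n <;> simp [freeBar, h, freeShift_X]

theorem freeShift_relator (n i : ℕ) (a : ℂ) :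
    freeShift n (relator n i a) = relator n i (a - 2) := by
  have h : a - 2 * n + 2 * i - 4 - 2 = a - 2 - 2 * n + 2 * i - 4 := by ring
  simp only [relator, map_sub, map_mul, freeShift_freePos, freeShift_freeBar, h]

theorem relIdeal_le_comap (n : ℕ) : relIdeal n ≤ (relIdeal n).comap (freeShift n) := by
  rw [relIdeal, Ideal.span_le]
  rintro r ⟨i, a, h1, h2, rfl⟩
  refine Ideal.subset_span ⟨i, a - 2, h1, h2, ?_⟩
  exact freeShift_relator n i a

/-- The endomorphism `z_{x,a} ↦ z_{x,a-2}` of `𝒵`. -/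
def shift (n : ℕ) : ZRing n →+* ZRing n :=
  Ideal.quotientMap (relIdeal n) (freeShift n) (relIdeal_le_comap n)

theorem shift_z {n : ℕ} (x : Letter n) (a : ℂ) : shift n (z x a) = z x (a - 2) := by
  simp [shift, z, freeShift_X]

/-! ## Generating series and Jacobi-Trudi determinants -/

/-- The ring `𝒜`: series in `X` over `𝒵` with `X z_{x,a} = z_{x,a-2} X`. -/
abbrev ARing (n : ℕ) : Type := SkewSeries (shift n)

/-- The element `z_{x,a} X` of `𝒜`. -/
def zX {n : ℕ} (x : Letter n) (a : ℂ) : ARing n := SkewSeries.C (z x a) * SkewSeries.X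

theorem coeff_zero_zX {n : ℕ} (x : Letter n) (a : ℂ) : (zX x a).coeff 0 = 0 := by
  simp [zX, SkewSeries.coeff_mul, SkewSeries.X]

/-- The largest unbarred index, i.e. the letter `n` is `pos (lastIdx hn)`. -/
def lastIdx {n : ℕ} (hn : 1 ≤ n) : Fin n := ⟨n - 1, by omega⟩

/-- The element `z_{n,a} X z_{n̄,a} X`. -/
def zXnn {n : ℕ} (hn : 1 ≤ n) (a : ℂ) : ARing n :=
  zX (Letter.pos (lastIdx hn)) a * zX (Letter.bar (lastIdx hn)) a

/-- `(1 + z_{1,a}X)⋯(1 + z_{n,a}X) (1 - z_{n,a}X z_{n̄,a}X) (1 + z_{n̄,a}X)⋯(1 + z_{1̄,a}X)`. -/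
def E {n : ℕ} (hn : 1 ≤ n) (a : ℂ) : ARing n :=
  ((List.finRange n).map fun k => 1 + zX (Letter.pos k) a).prod
    * (1 - zXnn hn a)
    * ((List.finRange n).reverse.map fun k => 1 + zX (Letter.bar k) a).prod

/-- `(1 - z_{1̄,a}X)⁻¹⋯(1 - z_{n̄,a}X)⁻¹ (1 - z_{n,a}X z_{n̄,a}X)⁻¹
(1 - z_{n,a}X)⁻¹⋯(1 - z_{1,a}X)⁻¹`, where `(1 - f)⁻¹` is `SkewSeries.geom f`. -/
def H {n : ℕ} (hn : 1 ≤ n) (a : ℂ) : ARing n :=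
  ((List.finRange n).map fun k => SkewSeries.geom (zX (Letter.bar k) a)).prod
    * SkewSeries.geom (zXnn hn a)
    * ((List.finRange n).reverse.map fun k => SkewSeries.geom (zX (Letter.pos k) a)).prod

/-- `e_{i,a}`, the coefficient of `Xⁱ` in `E_a`, and `0` for `i < 0`. -/
def e {n : ℕ} (hn : 1 ≤ n) (i : ℤ) (a : ℂ) : ZRing n :=
  if 0 ≤ i then (E hn a).coeff i.toNat else 0

/-- `h_{i,a}`, the coefficient of `Xⁱ` in `H_a`, and `0` for `i < 0`. -/
def h {n : ℕ} (hn : 1 ≤ n) (i : ℤ) (a : ℂ) : ZRing n :=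
  if 0 ≤ i then (H hn a).coeff i.toNat else 0

/-- The length of a partition: the number of its non-zero rows. -/
def len (lam : YoungDiagram) : ℕ := lam.colLen 0

/-- `det (h_{λ_i - μ_j - i + j, a + 2(λ_i - i)})_{1 ≤ i, j ≤ l}` (rows and columns of the matrix,
and rows of the diagrams, are numbered from `0` in the code). -/
def detH {n : ℕ} (hn : 1 ≤ n) (lam mu : YoungDiagram) (l : ℕ) (a : ℂ) : ZRing n :=
  Matrix.det (Matrix.of fun i j : Fin l =>
    h hn ((lam.rowLen i : ℤ) - mu.rowLen j - (i : ℕ) + (j : ℕ))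
      (a + 2 * ((lam.rowLen i : ℂ) - ((i : ℕ) + 1))))

/-- `det (e_{λ'_i - μ'_j - i + j, a - 2(μ'_j - j + 1)})_{1 ≤ i, j ≤ l}` (rows and columns of the
matrix, and columns of the diagrams, are numbered from `0` in the code). -/
def detE {n : ℕ} (hn : 1 ≤ n) (lam mu : YoungDiagram) (l : ℕ) (a : ℂ) : ZRing n :=
  Matrix.det (Matrix.of fun i j : Fin l =>
    e hn ((lam.colLen i : ℤ) - mu.colLen j - (i : ℕ) + (j : ℕ))
      (a - 2 * ((mu.colLen j : ℂ) - ((j : ℕ) + 1) + 1)))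

/-! ## Tableaux -/

/-- The boxes of the skew diagram `λ/μ`, as pairs (row, column), both numbered from `0`. -/
abbrev skewCells (lam mu : YoungDiagram) : Finset (ℕ × ℕ) := lam.cells \ mu.cells

/-- A filling of the boxes of `λ/μ` by letters. -/
abbrev Tableau (n : ℕ) (lam mu : YoungDiagram) : Type :=
  {c : ℕ × ℕ // c ∈ skewCells lam mu} → Letter n

/-- `z^T_a = ∏ z_{T(i,j), a + 2(j - i)}`. -/
def weight {n : ℕ} {lam mu : YoungDiagram} (T : Tableau n lam mu) (a : ℂ) : ZRing n :=
  ∏ c : {c : ℕ × ℕ // c ∈ skewCells lam mu}, z (T c) (a + 2 * ((c.1.2 : ℂ) - (c.1.1 : ℂ)))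

/-- The horizontal rule: horizontal neighbours `x, y` satisfy `x ⪯ y` or `(x, y) = (n̄, n)`, and
three consecutive boxes of a row never contain `(n̄, n̄, n)` or `(n̄, n, n)`. -/
def HRule {n : ℕ} {lam mu : YoungDiagram} (T : Tableau n lam mu) : Prop :=
  (∀ (i j : ℕ) (h0 : (i, j) ∈ skewCells lam mu) (h1 : (i, j + 1) ∈ skewCells lam mu),
      T ⟨_, h0⟩ ≤ T ⟨_, h1⟩ ∨ ((T ⟨_, h0⟩).IsNBar ∧ (T ⟨_, h1⟩).IsN)) ∧
  (∀ (i j : ℕ) (h0 : (i, j) ∈ skewCells lam mu) (h1 : (i, j + 1) ∈ skewCells lam mu)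
      (h2 : (i, j + 2) ∈ skewCells lam mu),
      ¬ ((T ⟨_, h0⟩).IsNBar ∧ (T ⟨_, h1⟩).IsNBar ∧ (T ⟨_, h2⟩).IsN) ∧
      ¬ ((T ⟨_, h0⟩).IsNBar ∧ (T ⟨_, h1⟩).IsN ∧ (T ⟨_, h2⟩).IsN))

/-- The vertical rule: vertical neighbours `x` (above), `y` (below) satisfy `x ≺ y`, or
`x = y = n` and `n̄` stands directly to the left of the lower box, or
`x = y = n̄` and `n` stands directly to the right of the upper box. -/
def VRule {n : ℕ} {lam mu : YoungDiagram} (T : Tableau n lam mu) : Prop :=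
  ∀ (i j : ℕ) (h0 : (i, j) ∈ skewCells lam mu) (h1 : (i + 1, j) ∈ skewCells lam mu),
    T ⟨_, h0⟩ < T ⟨_, h1⟩ ∨
    ((T ⟨_, h0⟩).IsN ∧ (T ⟨_, h1⟩).IsN ∧
      ∃ (j' : ℕ) (_ : j' + 1 = j) (h2 : (i + 1, j') ∈ skewCells lam mu), (T ⟨_, h2⟩).IsNBar) ∨
    ((T ⟨_, h0⟩).IsNBar ∧ (T ⟨_, h1⟩).IsNBar ∧
      ∃ h2 : (i, j + 1) ∈ skewCells lam mu, (T ⟨_, h2⟩).IsN)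

/-- The extra rule for columns: if a column segment of `l ≥ 2` boxes has `c` at its top and `c̄` at
its bottom, for some `1 ≤ c ≤ n`, then `l - 1 ≤ n - c`. -/
def E1CRule {n : ℕ} {lam mu : YoungDiagram} (T : Tableau n lam mu) : Prop :=
  ∀ (i j l : ℕ) (c : Fin n), 2 ≤ l →
    ∀ (h0 : (i, j) ∈ skewCells lam mu) (h1 : (i + (l - 1), j) ∈ skewCells lam mu),
      T ⟨_, h0⟩ = Letter.pos c → T ⟨_, h1⟩ = Letter.bar c → l - 1 ≤ n - ((c : ℕ) + 1)

open Classical in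
/-- The set `Tab(C_n, λ/μ)` for one-column diagrams. -/
def Tab (n : ℕ) (lam mu : YoungDiagram) : Finset (Tableau n lam mu) :=
  Finset.univ.filter fun T => HRule T ∧ VRule T ∧ E1CRule T

end TypeC

end

/-!
# Columns of type `C_n`

Let `L` and `M` be the heights of the one-column diagram `λ` and of `μ`. Both determinants equal
`e_{L-M, a-2M}`. The second one is unitriangular apart from its first entry (`detE_column`). From
the first one, unitriangular parts split off until the matrix `(h_{1-i+j, a-2(M+i)})` of size
`L - M` is left (`detH_column`), and since `H(X) E(-X) = 1`, this is a minor of a unitriangular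
matrix whose inverse has the entries `±e_{j-i}` (`det_hessenberg_eq`).

It remains to compare `e_d` for `d ≤ n + 1` with the sum over columns. Let `F_N` be the part of the
product `E` that involves only the last `N` unbarred letters and their bars, together with the
middle factor, so that `F_{N+1} = (1 + z_i X) F_N (1 + z_ī X)` with `i = n - N`. The heart of the
proof is an antisymmetry of its homogeneous parts (`nestCoeff_antisymm`): `F_N^{(N+1)} = 0` and
`F_N^{(N+1+m)} = -(z_i X)^m F_N^{(N+1-m)} (z_ī X)^m`. It goes by induction on `N`. The relation of
`𝒵` for the letter `i` concerns `z_i` and `z_ī` standing `N + 2` places apart, which is exactly the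
distance at which they occur in the inductive step.

The sum `T_N^{(d)}` over admissible columns of length `d` in the same letters is split according to
which of `i` and `ī` occur. This gives the recursion of `F_{N+1}^{(d)}`, except that columns with
both letters occur only for `d ≤ N + 1`, because the extra rule bounds the distance of the first and
last box (`colSum_succ`). Hence `T_N^{(d)} = 0` for `d > N`, and the vanishing of `F_N^{(N+1)}`
makes `T_N^{(d)} = F_N^{(d)}` pass through the induction for all `d ≤ N + 1`
(`colSum_eq_nestCoeff`). The case `N = n` is the assertion.

The parameters `a - 2s` that occur for a fixed `a` are encoded by the integer `s`.
-/

noncomputable section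

/-! ### Antisymmetry of the coefficients of nested products -/

namespace TypeC

/-- The coefficients of the series
`(1 + u_{N-1}X)⋯(1 + u₀X) (1 - u₀X v₀X) (1 + v₀X)⋯(1 + v_{N-1}X)`, by recursion on `N`. The degree
`d` is an integer, and the coefficients of negative degree are `0`; `u N s` and `v N s` are the
`s`-fold shifts of `u_N` and `v_N`, and the value at `s` is the `s`-fold shift of the
coefficient. -/
def nestCoeff {R : Type*} [CommRing R] (u v : ℕ → ℤ → R) : ℕ → ℤ → ℤ → R
  | 0, d, s => if d = 0 then 1 else if d = 2 then -(u 0 s * v 0 (s + 1)) else 0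
  | N + 1, d, s =>
      nestCoeff u v N d s + u N s * nestCoeff u v N (d - 1) (s + 1)
        + nestCoeff u v N (d - 1) s * v N (s + d - 1)
        + u N s * nestCoeff u v N (d - 2) (s + 1) * v N (s + d - 1)

section Nest

variable {R : Type*} [CommRing R]

theorem nestCoeff_of_neg (u v : ℕ → ℤ → R) (N : ℕ) {d : ℤ} (s : ℤ) (hd : d < 0) :
    nestCoeff u v N d s = 0 := by
  induction N generalizing d s with
  | zero => simp [nestCoeff, show d ≠ 0 by omega, show d ≠ 2 by omega]
  | succ N ih =>
    simp [nestCoeff, ih s hd, ih s (show d - 1 < 0 by omega), ih (s + 1) (show d - 1 < 0 by omega),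
      ih (s + 1) (show d - 2 < 0 by omega)]

theorem map_nestCoeff {u v : ℕ → ℤ → R} (σ : R →+* R) (hu : ∀ N s, σ (u N s) = u N (s + 1))
    (hv : ∀ N s, σ (v N s) = v N (s + 1)) (N : ℕ) (d s : ℤ) :
    σ (nestCoeff u v N d s) = nestCoeff u v N d (s + 1) := by
  induction N generalizing d s with
  | zero =>
    simp only [nestCoeff]
    split_ifs <;> simp [hu, hv]
  | succ N ih =>
    simp only [nestCoeff, map_add, map_mul, ih, hu, hv]
    rw [show s + d - 1 + 1 = s + 1 + d - 1 by ring]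

/-- The product `w(s) w(s+1) ⋯ w(s+m-1)` of successive shifts. -/
def shiftProd (w : ℤ → R) (m : ℕ) (s : ℤ) : R := ∏ t ∈ Finset.range m, w (s + t)

theorem shiftProd_succ (w : ℤ → R) (m : ℕ) (s : ℤ) :
    shiftProd w (m + 1) s = shiftProd w m s * w (s + m) :=
  Finset.prod_range_succ _ _

theorem shiftProd_succ' (w : ℤ → R) (m : ℕ) (s : ℤ) :
    shiftProd w (m + 1) s = w s * shiftProd w m (s + 1) := by
  rw [shiftProd, Finset.prod_range_succ', mul_comm, shiftProd]
  congr 1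
  · simp
  · refine Finset.prod_congr rfl fun t _ => ?_
    congr 1
    push_cast
    ring

/-- Write `F_d` for the homogeneous part of degree `d`. Then `F_{N+1} = 0` and
`F_{N+1+m} = -(u_N X)^m F_{N+1-m} (v_N X)^m`. In the inductive step the recursion gives this
equation with `u_N`, `v_N` in place of `u_{N+1}`, `v_{N+1}`; each factor `u_N` stands `N + 2` places
before the corresponding `v_N`, so `hrel` raises the index. The vanishing of `F_{N+1}` is a
separate clause because the equation for `m = 0` only says that its double is zero. -/
theorem nestCoeff_antisymm {u v : ℕ → ℤ → R} {n : ℕ}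
    (hrel : ∀ N < n, ∀ s : ℤ, u N s * v N (s + N + 2) = u (N + 1) s * v (N + 1) (s + N + 2))
    {N : ℕ} (hN : N ≤ n) :
    (∀ s, nestCoeff u v N (N + 1) s = 0) ∧
    ∀ (m : ℕ) (s : ℤ), nestCoeff u v N (N + 1 + m) s =
      -(nestCoeff u v N (N + 1 - m) (s + m)
        * (shiftProd (u N) m s * shiftProd (v N) m (s + N + 1))) := by
  induction N with
  | zero =>
    refine ⟨fun s => by simp [nestCoeff], fun m s => ?_⟩
    rcases m with _ | _ | m
    · simp [nestCoeff]
    · simp [nestCoeff, shiftProd]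
    · rw [nestCoeff_of_neg u v 0 _ (show ((0 : ℕ) : ℤ) + 1 - ((m + 1 + 1 : ℕ) : ℤ) < 0 by
        push_cast; omega)]
      simp only [nestCoeff]
      rw [if_neg (by push_cast; omega), if_neg (by push_cast; omega)]
      simp
  | succ N ih =>
    obtain ⟨ih0, ih⟩ := ih (by omega)
    have hzero : ∀ s, nestCoeff u v (N + 1) ((N + 1 : ℕ) + 1) s = 0 := by
      intro s
      have h1 := ih 1 s
      simp only [shiftProd, Finset.prod_range_one, Nat.cast_one, Nat.cast_zero, add_zero] at h1
      rw [nestCoeff]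
      push_cast
      rw [h1, show (N : ℤ) + 1 + 1 - 1 = N + 1 by ring, ih0, ih0,
        show (N : ℤ) + 1 + 1 - 2 = N + 1 - 1 by ring, show s + (N + 1 + 1) - 1 = s + N + 1 by ring]
      ring
    refine ⟨hzero, fun m s => ?_⟩
    rcases m with _ | m
    · have h0 := hzero s
      have h0' := hzero (s + (0 : ℕ))
      simp only [Nat.cast_zero, add_zero, sub_zero] at h0 h0' ⊢
      rw [h0]
      simp
    · -- The only use of `hrel`: the two monomials in front of `F_{N+2-(m+1)}` agree.
      have hprod : shiftProd (u (N + 1)) (m + 1) s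
            * shiftProd (v (N + 1)) (m + 1) (s + (N + 1 : ℕ) + 1)
          = shiftProd (u N) (m + 1) s * shiftProd (v N) (m + 1) (s + N + 2) := by
        simp only [shiftProd, ← Finset.prod_mul_distrib]
        refine Finset.prod_congr rfl fun t _ => ?_
        rw [show s + (N + 1 : ℕ) + 1 + (t : ℤ) = s + t + N + 2 by push_cast; ring,
          ← hrel N (by omega), show s + N + 2 + (t : ℤ) = s + t + N + 2 by ring]
      have ih' : ∀ (m : ℕ) {d d' s s' t : ℤ}, d = N + 1 + m → d' = N + 1 - m → s' = s + m →
          t = s + N + 1 → nestCoeff u v N d s = -(nestCoeff u v N d' s'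
            * (shiftProd (u N) m s * shiftProd (v N) m t)) := by
        rintro m d d' s s' t rfl rfl rfl rfl
        exact ih m s
      have h1 : nestCoeff u v N (N + m + 3) s = -(nestCoeff u v N (N - m - 1) (s + m + 2)
          * (shiftProd (u N) (m + 1 + 1) s * shiftProd (v N) (m + 1 + 1) (s + N + 1))) := by
        apply ih' (m + 2) <;> push_cast <;> ring
      have h2 : nestCoeff u v N (N + m + 2) (s + 1) = -(nestCoeff u v N (N - m) (s + m + 2)
          * (shiftProd (u N) (m + 1) (s + 1) * shiftProd (v N) (m + 1) (s + N + 2))) := by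
        apply ih' (m + 1) <;> push_cast <;> ring
      have h3 : nestCoeff u v N (N + m + 2) s = -(nestCoeff u v N (N - m) (s + m + 1)
          * (shiftProd (u N) (m + 1) s * shiftProd (v N) (m + 1) (s + N + 1))) := by
        apply ih' (m + 1) <;> push_cast <;> ring
      have h4 : nestCoeff u v N (N + m + 1) (s + 1) = -(nestCoeff u v N (N + 1 - m) (s + m + 1)
          * (shiftProd (u N) m (s + 1) * shiftProd (v N) m (s + N + 2))) := by
        apply ih' m <;> ring
      have hu := shiftProd_succ' (u N) (m + 1) s
      have hu' := shiftProd_succ (u N) (m + 1) s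
      have hu'' := shiftProd_succ' (u N) m s
      have hv := shiftProd_succ' (v N) (m + 1) (s + N + 1)
      have hv' := shiftProd_succ (v N) (m + 1) (s + N + 1)
      have hv'' := shiftProd_succ (v N) m (s + N + 2)
      rw [show s + N + 1 + 1 = s + N + 2 by ring] at hv
      rw [show s + N + 1 + ((m + 1 : ℕ) : ℤ) = s + N + m + 2 by push_cast; ring] at hv'
      rw [show s + N + 2 + (m : ℤ) = s + N + m + 2 by ring] at hv''
      rw [show s + ((m + 1 : ℕ) : ℤ) = s + m + 1 by push_cast; ring] at hu'
      rw [hprod, nestCoeff, nestCoeff]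
      rw [show ((N + 1 : ℕ) : ℤ) + 1 + ((m + 1 : ℕ) : ℤ) = N + m + 3 by push_cast; ring,
        show ((N + 1 : ℕ) : ℤ) + 1 - ((m + 1 : ℕ) : ℤ) = N + 1 - m by push_cast; ring,
        show (N : ℤ) + m + 3 - 1 = N + m + 2 by ring,
        show (N : ℤ) + m + 3 - 2 = N + m + 1 by ring,
        show (N : ℤ) + 1 - m - 1 = N - m by ring,
        show (N : ℤ) + 1 - m - 2 = N - m - 1 by ring,
        show s + ((m + 1 : ℕ) : ℤ) = s + m + 1 by push_cast; ring,
        show s + (N + m + 3) - 1 = s + N + m + 2 by ring,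
        show s + m + 1 + (N + 1 - m) - 1 = s + N + 1 by ring,
        show s + m + 1 + 1 = s + m + 2 by ring, h1, h2, h3, h4]
      linear_combination
        -nestCoeff u v N (N - m - 1) (s + m + 2) * (shiftProd (u N) (m + 1 + 1) s * hv
            + v N (s + N + 1) * shiftProd (v N) (m + 1) (s + N + 2) * hu')
          + nestCoeff u v N (N - m) (s + m + 2) * shiftProd (v N) (m + 1) (s + N + 2) * (hu - hu')
          + nestCoeff u v N (N - m) (s + m + 1) * shiftProd (u N) (m + 1) s * (hv' - hv)
          + nestCoeff u v N (N + 1 - m) (s + m + 1) * (shiftProd (v N) (m + 1) (s + N + 2) * hu''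
            + u N s * shiftProd (u N) m (s + 1) * hv'')

end Nest

/-! ### Determinants of Toeplitz type -/

section Determinants

variable {R : Type*} [CommRing R]

/-- Rows from the `m`-th on that are those of an upper unitriangular matrix can be split off. -/
theorem det_trim_last (A : ℕ → ℕ → R) (m r : ℕ) (h0 : ∀ i j, m ≤ i → j < i → A i j = 0)
    (h1 : ∀ i, m ≤ i → A i i = 1) :
    (Matrix.of fun i j : Fin (m + r) => A i j).det = (Matrix.of fun i j : Fin m => A i j).det := by
  induction r with
  | zero => rfl
  | succ r ih =>
    rw [← ih]
    change (Matrix.of fun i j : Fin (m + r + 1) => A i j).det = _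
    rw [Matrix.det_succ_row _ (Fin.last _), Finset.sum_eq_single (Fin.last _)]
    · simp [h1, ← two_mul, pow_mul]
      rfl
    · intro j _ hj
      have : (j : ℕ) < m + r := by
        have := Fin.val_lt_last hj
        simpa using this
      simp [h0 (m + r) j (by omega) this]
    · simp

/-- Columns before the `m`-th that are those of an upper unitriangular matrix can be split off. -/
theorem det_trim_first (A : ℕ → ℕ → R) (m k : ℕ) (h0 : ∀ i j, j < m → j < i → A i j = 0)
    (h1 : ∀ i, i < m → A i i = 1) :
    (Matrix.of fun i j : Fin (m + k) => A i j).det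
      = (Matrix.of fun i j : Fin k => A (m + i) (m + j)).det := by
  induction m generalizing A with
  | zero =>
    have e : 0 + k = k := by omega
    rw [← Matrix.det_submatrix_equiv_self (finCongr e).symm]
    congr 1
    ext i j
    simp
  | succ m ih =>
    have e : m + 1 + k = m + k + 1 := by omega
    rw [← Matrix.det_submatrix_equiv_self (finCongr e).symm, Matrix.det_succ_column_zero,
      Finset.sum_eq_single 0]
    · have := ih (fun i j => A (i + 1) (j + 1)) (fun i j hj hij => h0 _ _ (by omega) (by omega))
        (fun i hi => h1 _ (by omega))
      simp only [show ∀ i, m + 1 + i = m + i + 1 by intro i; omega]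
      rw [← this]
      simp [h1 0 (by omega)]
      congr 1
    · intro i _ hi
      have : 0 < (i : ℕ) := Nat.pos_of_ne_zero fun h => hi (Fin.ext h)
      simp [h0 i 0 (by omega) this]
    · simp

/-- The unitriangular matrices `(g_{j-i})` and `(±f_{j-i})` of size `k + 1` are inverse to each
other. The matrix in question is `(g_{j-i})` without its last row and first column, so its
determinant is, up to sign, the top right entry of the inverse. -/
theorem det_hessenberg_eq {g f : ℤ → ℤ → R} (hg : ∀ d s, d < 0 → g d s = 0)
    (hf : ∀ d s, d < 0 → f d s = 0) (hg0 : ∀ s, g 0 s = 1)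
    (hgf : ∀ (m : ℕ) (s : ℤ), ∑ p ∈ Finset.HasAntidiagonal.antidiagonal m,
      g p.1 s * ((-1) ^ p.2 * f p.2 (s + p.1)) = if m = 0 then 1 else 0) (k : ℕ) (s : ℤ) :
    (Matrix.of fun i j : Fin k => g (1 - (i : ℕ) + (j : ℕ)) (s + (i : ℕ))).det = f k s := by
  let G : Matrix (Fin (k + 1)) (Fin (k + 1)) R :=
    Matrix.of fun i j => g ((j : ℕ) - (i : ℕ)) (s + (i : ℕ))
  let F : Matrix (Fin (k + 1)) (Fin (k + 1)) R :=
    Matrix.of fun i j => (-1) ^ ((j : ℕ) - (i : ℕ)) * f ((j : ℕ) - (i : ℕ)) (s + (i : ℕ))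
  have hdet : G.det = 1 := by
    rw [Matrix.det_of_isUpperTriangular]
    · simp [G, hg0]
    · intro i j hij
      have : (j : ℕ) < (i : ℕ) := hij
      exact hg _ _ (by omega)
  have hGF : G * F = 1 := by
    ext i c
    rw [Matrix.mul_apply, Matrix.one_apply]
    by_cases hic : i ≤ c
    · have hic' : (i : ℕ) ≤ c := hic
      have := hgf (c - i) (s + (i : ℕ))
      rw [show (if i = c then (1 : R) else 0) = if (c : ℕ) - i = 0 then 1 else 0 by
        simp [Fin.ext_iff]; congr 1; simp; omega, ← this]
      symm
      -- Only the indices `j` between `i` and `c` contribute; they are the `i + p.1`.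
      refine Finset.sum_bij_ne_zero (fun p hp _ => ⟨i + p.1, ?_⟩) ?_ ?_ ?_ ?_
      · rw [Finset.HasAntidiagonal.mem_antidiagonal] at hp
        omega
      · simp
      · rintro ⟨p, q⟩ hp _ ⟨p', q'⟩ hp' _ h
        simp only [Finset.HasAntidiagonal.mem_antidiagonal] at hp hp'
        simp at h ⊢
        omega
      · intro j _ hj
        have h1 : (i : ℕ) ≤ j := by
          by_contra h
          exact hj (by simp [G, hg _ _ (show ((j : ℕ) : ℤ) - (i : ℕ) < 0 by omega)])
        have h2 : (j : ℕ) ≤ c := by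
          by_contra h
          exact hj (by simp [F, hf _ _ (show ((c : ℕ) : ℤ) - (j : ℕ) < 0 by omega)])
        refine ⟨(j - i, c - j), by simp; omega, ?_, by ext; simp; omega⟩
        convert hj using 1
        simp only [G, F, Matrix.of_apply]
        rw [Nat.cast_sub h1, Nat.cast_sub h2, add_add_sub_cancel]
      · rintro ⟨p, q⟩ hp _
        simp only [Finset.HasAntidiagonal.mem_antidiagonal] at hp
        simp only [G, F, Matrix.of_apply]
        rw [show (c : ℕ) - ((i : ℕ) + p) = q by omega,
          show ((c : ℕ) : ℤ) - ((i : ℕ) + p : ℕ) = q by omega]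
        push_cast
        simp [add_assoc]
    · rw [if_neg (fun h => hic h.le)]
      refine Finset.sum_eq_zero fun j _ => ?_
      by_cases hij : (j : ℕ) < i
      · simp [G, hg _ _ (show ((j : ℕ) : ℤ) - (i : ℕ) < 0 by omega)]
      · have : (c : ℕ) < i := not_le.mp hic
        simp [F, hf _ _ (show ((c : ℕ) : ℤ) - (j : ℕ) < 0 by omega)]
  have hadj : G.adjugate = F := by
    calc G.adjugate = G.adjugate * (G * F) := by rw [hGF, mul_one]
      _ = F := by rw [← mul_assoc, Matrix.adjugate_mul, hdet, one_smul, one_mul]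
  have := congrFun (congrFun hadj 0) (Fin.last k)
  rw [Matrix.adjugate_fin_succ_eq_det_submatrix] at this
  simp only [F, Matrix.of_apply, Fin.val_last, Fin.val_zero, add_zero, Nat.sub_zero, Nat.cast_zero,
    sub_zero] at this
  have hunit : IsUnit ((-1 : R) ^ k) := (isUnit_one.neg).pow k
  rw [← hunit.mul_left_cancel this]
  congr 1
  ext i j
  simp [G]
  ring_nf

end Determinants

end TypeC

/-! ### Series with integer degrees and alternating signs -/

namespace SkewSeries

variable {R : Type*} [CommRing R] {σ : R →+* R}

/-- The coefficient of `X^d` for an integer `d`, equal to `0` for `d < 0`. -/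
def coeffInt (f : SkewSeries σ) (d : ℤ) : R := if 0 ≤ d then f.coeff d.toNat else 0

theorem coeffInt_add (f g : SkewSeries σ) (d : ℤ) :
    (f + g).coeffInt d = f.coeffInt d + g.coeffInt d := by
  simp only [coeffInt]
  split_ifs <;> simp

theorem coeff_C_mul_X (r : R) (m : ℕ) :
    (C r * X : SkewSeries σ).coeff m = if m = 1 then r else 0 := by
  rw [coeff_mul, Finset.sum_eq_single (0, m)]
  · simp [C, X]
  · rintro ⟨i, j⟩ hij hne
    have : i ≠ 0 := by
      rintro rfl
      simp at hij
      exact hne (by simp [hij])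
    simp [C, this]
  · intro h
    simp at h

theorem coeffInt_neg (f : SkewSeries σ) (d : ℤ) : (-f).coeffInt d = -f.coeffInt d := by
  simp only [coeffInt]
  split_ifs <;> simp

theorem coeffInt_one (d : ℤ) : (1 : SkewSeries σ).coeffInt d = if d = 0 then 1 else 0 := by
  rw [coeffInt, coeff_one]
  split_ifs <;> first | rfl | omega

theorem coeffInt_C_mul_X (r : R) (d : ℤ) :
    (C r * X : SkewSeries σ).coeffInt d = if d = 1 then r else 0 := by
  rw [coeffInt, coeff_C_mul_X]
  split_ifs <;> first | rfl | omega

theorem coeffInt_C_mul_X_mul (r : R) (f : SkewSeries σ) (d : ℤ) :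
    (C r * X * f).coeffInt d = r * σ (f.coeffInt (d - 1)) := by
  obtain hd | rfl | hd := lt_trichotomy d 0
  · simp [coeffInt, hd.not_ge, show ¬ (1 ≤ d) by omega]
  · rw [coeffInt, if_pos le_rfl, Int.toNat_zero, coeff_mul]
    simp [coeffInt, coeff_C_mul_X]
  · obtain ⟨m, rfl⟩ : ∃ m : ℕ, d = m + 1 := ⟨(d - 1).toNat, by omega⟩
    rw [add_sub_cancel_right]
    simp only [coeffInt, if_pos hd.le, Int.toNat_natCast, if_pos (Int.natCast_nonneg m)]
    rw [show ((m : ℤ) + 1).toNat = m + 1 by omega, coeff_mul, Finset.sum_eq_single (1, m)]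
    · simp [coeff_C_mul_X]
    · rintro ⟨i, j⟩ hij hne
      have : i ≠ 1 := by
        rintro rfl
        simp only [Finset.HasAntidiagonal.mem_antidiagonal] at hij
        exact hne (by simp; omega)
      simp [coeff_C_mul_X, this]
    · intro h
      simp at h
      omega

theorem coeffInt_mul_C_mul_X (r : R) (f : SkewSeries σ) (d : ℤ) :
    (f * (C r * X)).coeffInt d = f.coeffInt (d - 1) * (σ ^ (d - 1).toNat) r := by
  obtain hd | rfl | hd := lt_trichotomy d 0
  · simp [coeffInt, hd.not_ge, show ¬ (1 ≤ d) by omega]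
  · rw [coeffInt, if_pos le_rfl, Int.toNat_zero, coeff_mul]
    simp [coeffInt, coeff_C_mul_X]
  · obtain ⟨m, rfl⟩ : ∃ m : ℕ, d = m + 1 := ⟨(d - 1).toNat, by omega⟩
    rw [add_sub_cancel_right]
    simp only [coeffInt, if_pos hd.le, Int.toNat_natCast, if_pos (Int.natCast_nonneg m)]
    rw [show ((m : ℤ) + 1).toNat = m + 1 by omega, coeff_mul, Finset.sum_eq_single (m, 1)]
    · simp [coeff_C_mul_X]
    · rintro ⟨i, j⟩ hij hne
      have : j ≠ 1 := by
        rintro rfl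
        simp only [Finset.HasAntidiagonal.mem_antidiagonal] at hij
        exact hne (by simp; omega)
      simp [coeff_C_mul_X, this]
    · intro h
      simp at h

/-- The substitution `X ↦ -X`. -/
def alternate : SkewSeries σ →+* SkewSeries σ where
  toFun f := ⟨fun m => (-1) ^ m * f.coeff m⟩
  map_zero' := by ext m; simp
  map_one' := by
    ext m
    by_cases hm : m = 0 <;> simp [coeff_one, hm]
  map_add' f g := by ext m; simp [mul_add]
  map_mul' f g := by
    ext m
    simp only [coeff_mul, Finset.mul_sum]
    refine Finset.sum_congr rfl fun p hp => ?_
    rw [Finset.HasAntidiagonal.mem_antidiagonal] at hp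
    simp only [← hp, map_mul, map_pow, map_neg, map_one, pow_add]
    ring

theorem coeff_alternate (f : SkewSeries σ) (m : ℕ) :
    (alternate f).coeff m = (-1) ^ m * f.coeff m := rfl

theorem alternate_C_mul_X (r : R) : alternate (C r * X : SkewSeries σ) = -(C r * X) := by
  ext m
  rw [coeff_alternate, coeff_neg, coeff_C_mul_X]
  by_cases hm : m = 1 <;> simp [hm]

end SkewSeries

theorem List.prod_map_reverse_mul_prod_map {M ι : Type*} [Monoid M] {f g : ι → M}
    (hgf : ∀ i, g i * f i = 1) (l : List ι) : (l.reverse.map g).prod * (l.map f).prod = 1 := by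
  induction l with
  | nil => simp
  | cons i l ih =>
    simp only [List.reverse_cons, List.map_append, List.prod_append, List.map_cons,
      List.prod_cons, List.map_nil, List.prod_nil, mul_one]
    rw [mul_assoc, ← mul_assoc (g i), hgf, one_mul, ih]

namespace TypeC

/-- `z_{n-N,a-2s}`, the variable of the letter just before the last `N` unbarred ones. For `N = n`
it is `z_{0,a-2s} = 1`. -/
def outerPos (n : ℕ) (a : ℂ) (N : ℕ) (s : ℤ) : ZRing n :=
  Ideal.Quotient.mk (relIdeal n) (freePos n (n - N) (a - 2 * s))

/-- `z_{\overline{n-N},a-2s}`, the barred counterpart of `outerPos`. -/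
def outerBar (n : ℕ) (a : ℂ) (N : ℕ) (s : ℤ) : ZRing n :=
  Ideal.Quotient.mk (relIdeal n) (freeBar n (n - N) (a - 2 * s))

/-- The index of the letter `n - N`. -/
def outerIdx {n N : ℕ} (hN : N < n) : Fin n := ⟨n - (N + 1), by omega⟩

theorem outerPos_of_lt {n N : ℕ} (hN : N < n) (a : ℂ) (s : ℤ) :
    outerPos n a N s = z (Letter.pos (outerIdx hN)) (a - 2 * s) := by
  obtain ⟨k, hk⟩ : ∃ k, n - N = k + 1 := ⟨n - (N + 1), by omega⟩
  rw [outerPos, hk, freePos, dif_pos (by omega), z]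
  congr 5
  omega

theorem outerBar_of_lt {n N : ℕ} (hN : N < n) (a : ℂ) (s : ℤ) :
    outerBar n a N s = z (Letter.bar (outerIdx hN)) (a - 2 * s) := by
  obtain ⟨k, hk⟩ : ∃ k, n - N = k + 1 := ⟨n - (N + 1), by omega⟩
  rw [outerBar, hk, freeBar, dif_pos (by omega), z]
  congr 5
  omega

theorem shift_outerPos (n : ℕ) (a : ℂ) (N : ℕ) (s : ℤ) :
    shift n (outerPos n a N s) = outerPos n a N (s + 1) := by
  rw [outerPos, outerPos, shift, Ideal.quotientMap_mk, freeShift_freePos]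
  congr 2
  push_cast
  ring

theorem shift_outerBar (n : ℕ) (a : ℂ) (N : ℕ) (s : ℤ) :
    shift n (outerBar n a N s) = outerBar n a N (s + 1) := by
  rw [outerBar, outerBar, shift, Ideal.quotientMap_mk, freeShift_freeBar]
  congr 2
  push_cast
  ring

/-- The defining relation of `𝒵` for the letter `i = n - N`. -/
theorem outerPos_mul_outerBar {n N : ℕ} (hN : N < n) (a : ℂ) (s : ℤ) :
    outerPos n a N s * outerBar n a N (s + N + 2)
      = outerPos n a (N + 1) s * outerBar n a (N + 1) (s + N + 2) := by
  simp only [outerPos, outerBar, ← map_mul]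
  rw [Ideal.Quotient.eq]
  refine Ideal.subset_span ⟨n - N, a - 2 * s, by omega, by omega, ?_⟩
  rw [relator, show n - (N + 1) = n - N - 1 by omega]
  have : a - 2 * ((s + N + 2 : ℤ) : ℂ) = a - 2 * s - 2 * n + 2 * ((n - N : ℕ) : ℂ) - 4 := by
    rw [Nat.cast_sub hN.le]
    push_cast
    ring
  rw [this]

theorem shift_pow_z {n : ℕ} (x : Letter n) (a : ℂ) (m : ℕ) :
    (shift n ^ m) (z x a) = z x (a - 2 * m) := by
  induction m with
  | zero => simp
  | succ m ih =>
    rw [pow_succ', RingHom.coe_mul, Function.comp_apply, ih, shift_z]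
    congr 1
    push_cast
    ring

/-- The middle part of the product `E`, in which only the last `N` unbarred letters and their bars
occur. -/
def nestSeries {n : ℕ} (hn : 1 ≤ n) (N : ℕ) (a : ℂ) : ARing n :=
  (((List.finRange n).drop (n - N)).map fun k => 1 + zX (Letter.pos k) a).prod
    * (1 - zXnn hn a)
    * (((List.finRange n).drop (n - N)).reverse.map fun k => 1 + zX (Letter.bar k) a).prod

theorem nestSeries_self {n : ℕ} (hn : 1 ≤ n) (a : ℂ) : nestSeries hn n a = E hn a := by
  simp [nestSeries, E]

theorem nestSeries_succ {n : ℕ} (hn : 1 ≤ n) {N : ℕ} (hN : N < n) (a : ℂ) :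
    nestSeries hn (N + 1) a = (1 + zX (Letter.pos (outerIdx hN)) a) * nestSeries hn N a
      * (1 + zX (Letter.bar (outerIdx hN)) a) := by
  have hd : (List.finRange n).drop (n - (N + 1))
      = outerIdx hN :: (List.finRange n).drop (n - N) := by
    rw [List.drop_eq_getElem_cons (by simp; omega), show n - (N + 1) + 1 = n - N by omega]
    simp [outerIdx]
  simp only [nestSeries, hd, List.map_cons, List.prod_cons, List.reverse_cons, List.map_append,
    List.prod_append, List.map_nil, List.prod_nil, mul_one, mul_assoc]

theorem coeffInt_nestSeries {n : ℕ} (hn : 1 ≤ n) (a : ℂ) {N : ℕ} (hN : N ≤ n) (d s : ℤ) :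
    (nestSeries hn N (a - 2 * s)).coeffInt d = nestCoeff (outerPos n a) (outerBar n a) N d s := by
  induction N generalizing d with
  | zero =>
    have h0 : nestSeries hn 0 (a - 2 * s) = 1 + -zXnn hn (a - 2 * s) := by
      rw [nestSeries, tsub_zero, List.drop_eq_nil_of_le (by simp)]
      simp [sub_eq_add_neg]
    have hidx : outerIdx (show 0 < n by omega) = lastIdx hn := rfl
    rw [h0, nestCoeff, outerPos_of_lt (by omega), outerBar_of_lt (by omega), hidx]
    have h1 := SkewSeries.coeffInt_C_mul_X_mul (σ := shift n)
      (z (Letter.pos (lastIdx hn)) (a - 2 * s)) (zX (Letter.bar (lastIdx hn)) (a - 2 * s)) d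
    change (zXnn hn (a - 2 * s)).coeffInt d = _ at h1
    rw [zX, SkewSeries.coeffInt_C_mul_X] at h1
    rw [SkewSeries.coeffInt_add, SkewSeries.coeffInt_neg, SkewSeries.coeffInt_one, h1]
    rcases eq_or_ne d 0 with rfl | h0
    · simp
    · rcases eq_or_ne d 2 with rfl | h2
      · rw [show (2 : ℤ) - 1 = 1 by norm_num, if_pos rfl, shift_z]
        have : a - 2 * (s : ℂ) - 2 = a - 2 * ((s + 1 : ℤ) : ℂ) := by
          push_cast
          ring
        simp [this]
      · simp [h0, h2, show d - 1 ≠ 1 by omega]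
  | succ N ih =>
    have ih := ih (by omega)
    rw [nestSeries_succ hn (by omega), nestCoeff, outerPos_of_lt (by omega),
      outerBar_of_lt (by omega), ← ih, ← map_nestCoeff (shift n) (shift_outerPos n a)
      (shift_outerBar n a), ← map_nestCoeff (shift n) (shift_outerPos n a)
      (shift_outerBar n a), ← ih, ← ih]
    rw [mul_add, mul_one, add_mul, one_mul, SkewSeries.coeffInt_add, SkewSeries.coeffInt_add]
    simp only [zX]
    rw [SkewSeries.coeffInt_mul_C_mul_X, SkewSeries.coeffInt_add, SkewSeries.coeffInt_C_mul_X_mul,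
      SkewSeries.coeffInt_C_mul_X_mul, shift_pow_z, show d - 1 - 1 = d - 2 by ring]
    -- For `d ≤ 0` the truncation in `(d - 1).toNat` is harmless, as the other factor is `0`.
    by_cases hd : 1 ≤ d
    · have : a - 2 * (s : ℂ) - 2 * ((d - 1).toNat : ℂ) = a - 2 * ((s + d - 1 : ℤ) : ℂ) := by
        rw [← Int.cast_natCast, Int.toNat_of_nonneg (by omega)]
        push_cast
        ring
      rw [this]
      ring
    · simp [SkewSeries.coeffInt, show ¬ (1 ≤ d) from hd, show ¬ (2 ≤ d) by omega]

theorem e_eq_nestCoeff {n : ℕ} (hn : 1 ≤ n) (a : ℂ) (d s : ℤ) :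
    e hn d (a - 2 * s) = nestCoeff (outerPos n a) (outerBar n a) n d s := by
  rw [← coeffInt_nestSeries hn a le_rfl, nestSeries_self]
  rfl

/-- The signs `X ↦ -X` do not affect the middle factor, which has degree `2`, so every factor of the
alternating `E` is the inverse of a factor of `H`. -/
theorem H_mul_alternate_E {n : ℕ} (hn : 1 ≤ n) (a : ℂ) :
    H hn a * SkewSeries.alternate (E hn a) = 1 := by
  have hz : ∀ x : Letter n, SkewSeries.alternate (1 + zX x a) = 1 - zX x a := fun x => by
    rw [map_add, map_one, zX, SkewSeries.alternate_C_mul_X, sub_eq_add_neg]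
  have hzz : SkewSeries.alternate (1 - zXnn hn a) = 1 - zXnn hn a := by
    rw [map_sub, map_one, zXnn, map_mul, zX, zX, SkewSeries.alternate_C_mul_X,
      SkewSeries.alternate_C_mul_X, neg_mul_neg]
  have hpos := List.prod_map_reverse_mul_prod_map
    (fun k : Fin n => SkewSeries.geom_mul_one_sub (coeff_zero_zX (Letter.pos k) a))
    (List.finRange n)
  have hbar := List.prod_map_reverse_mul_prod_map
    (fun k : Fin n => SkewSeries.geom_mul_one_sub (coeff_zero_zX (Letter.bar k) a))
    (List.finRange n).reverse
  have hmid : SkewSeries.geom (zXnn hn a) * (1 - zXnn hn a) = 1 :=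
    SkewSeries.geom_mul_one_sub (by simp [zXnn, SkewSeries.coeff_mul, coeff_zero_zX])
  rw [List.reverse_reverse] at hbar
  rw [H, E, map_mul, map_mul, map_list_prod, map_list_prod, List.map_map, List.map_map, hzz]
  simp only [Function.comp_def, hz]
  simp only [mul_assoc]
  rw [← mul_assoc _ _ ((1 - zXnn hn a) * _), hpos, one_mul, ← mul_assoc _ (1 - zXnn hn a), hmid,
    one_mul, hbar]

theorem sum_antidiagonal_h_mul_e {n : ℕ} (hn : 1 ≤ n) (a : ℂ) (m : ℕ) (s : ℤ) :
    ∑ p ∈ Finset.HasAntidiagonal.antidiagonal m,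
      h hn p.1 (a - 2 * s) * ((-1) ^ p.2 * e hn p.2 (a - 2 * ((s + p.1 : ℤ) : ℂ)))
      = if m = 0 then 1 else 0 := by
  have key := congrArg (fun f => SkewSeries.coeff f m) (H_mul_alternate_E hn (a - 2 * s))
  simp only [SkewSeries.coeff_mul, SkewSeries.coeff_alternate, SkewSeries.coeff_one] at key
  rw [← key]
  refine Finset.sum_congr rfl fun p _ => ?_
  have hshift : ∀ i : ℕ, (shift n ^ i) (e hn p.2 (a - 2 * s))
      = e hn p.2 (a - 2 * ((s + i : ℤ) : ℂ)) := by
    intro i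
    rw [e_eq_nestCoeff, e_eq_nestCoeff]
    induction i with
    | zero => simp
    | succ i ih =>
      rw [pow_succ', RingHom.coe_mul, Function.comp_apply, ih,
        map_nestCoeff (shift n) (shift_outerPos n a) (shift_outerBar n a)]
      push_cast
      rw [add_assoc]
  rw [← hshift, map_mul, map_pow, map_neg, map_one]
  simp [h, e]

end TypeC

/-! ### Sums over admissible columns -/

namespace TypeC

/-- The weight of the column with set of entries `S`, read in increasing order from top to bottom,
whose top box carries the shift `s`. -/
def colWeight {α R : Type*} [LinearOrder α] [CommRing R] (w : α → ℤ → R) (S : Finset α) (s : ℤ) :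
    R :=
  ∏ x ∈ S, w x (s + (S.filter (· < x)).card)

section ColWeight

variable {α R : Type*} [LinearOrder α] [CommRing R]

theorem colWeight_insert_min [DecidableEq α] (w : α → ℤ → R) {S : Finset α} {p : α}
    (hp : ∀ y ∈ S, p < y) (s : ℤ) :
    colWeight w (insert p S) s = w p s * colWeight w S (s + 1) := by
  have hpS : p ∉ S := fun h => (hp p h).false
  rw [colWeight, Finset.prod_insert hpS]
  congr 1
  · rw [Finset.filter_false_of_mem]
    · simp
    · intro y hy
      rcases Finset.mem_insert.mp hy with rfl | hy
      · exact lt_irrefl _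
      · exact (hp y hy).asymm
  · refine Finset.prod_congr rfl fun x hx => ?_
    rw [Finset.filter_insert, if_pos (hp x hx), Finset.card_insert_of_notMem (by simp [hpS])]
    push_cast
    rw [add_assoc, add_comm (1 : ℤ)]

theorem colWeight_insert_max [DecidableEq α] (w : α → ℤ → R) {S : Finset α} {b : α}
    (hb : ∀ y ∈ S, y < b) (s : ℤ) :
    colWeight w (insert b S) s = colWeight w S s * w b (s + S.card) := by
  have hbS : b ∉ S := fun h => (hb b h).false
  rw [colWeight, Finset.prod_insert hbS, mul_comm]
  congr 1
  · refine Finset.prod_congr rfl fun x hx => ?_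
    rw [Finset.filter_insert, if_neg (hb x hx).asymm]
  · rw [Finset.filter_insert, if_neg (lt_irrefl b), Finset.filter_true_of_mem hb]

end ColWeight

/-- The index `c` of the letters `c` and `c̄`. -/
def Letter.idx {n : ℕ} : Letter n → Fin n
  | .pos i => i
  | .bar i => i

theorem Letter.lt_iff_rank_lt {n : ℕ} {x y : Letter n} : x < y ↔ x.rank < y.rank := Iff.rfl

theorem Letter.pos_lt_bar {n : ℕ} (i j : Fin n) : Letter.pos i < Letter.bar j := by
  rw [Letter.lt_iff_rank_lt]
  simp only [Letter.rank]
  omega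

theorem Letter.pos_lt_of_lt_idx {n : ℕ} {k : Fin n} {x : Letter n} (hk : k < x.idx) :
    Letter.pos k < x := by
  rcases x with i | i
  · rw [Letter.lt_iff_rank_lt]
    have : (k : ℕ) < i := hk
    simpa [Letter.rank] using this
  · exact Letter.pos_lt_bar _ _

theorem Letter.lt_bar_of_lt_idx {n : ℕ} {k : Fin n} {x : Letter n} (hk : k < x.idx) :
    x < Letter.bar k := by
  rcases x with i | i
  · exact Letter.pos_lt_bar _ _
  · rw [Letter.lt_iff_rank_lt]
    have : (k : ℕ) < i := hk
    simp only [Letter.rank]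
    omega

/-- The condition on the set of entries of a column that expresses the extra rule: the number of
entries from `c` (included) to `c̄` (excluded) is the distance `l - 1` of their boxes. The letter
`c` has index `c - 1` here. -/
def Admissible {n : ℕ} (S : Finset (Letter n)) : Prop :=
  ∀ c : Fin n, Letter.pos c ∈ S → Letter.bar c ∈ S →
    (S.filter fun y => Letter.pos c ≤ y ∧ y < Letter.bar c).card ≤ n - ((c : ℕ) + 1)

section Admissible

variable {n : ℕ} {k : Fin n} {S : Finset (Letter n)}

theorem filter_window_insert {c : Fin n} {q : Letter n}
    (hq : q < Letter.pos c ∨ Letter.bar c ≤ q) :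
    ((insert q S).filter fun y => Letter.pos c ≤ y ∧ y < Letter.bar c)
      = S.filter fun y => Letter.pos c ≤ y ∧ y < Letter.bar c := by
  rw [Finset.filter_insert, if_neg]
  rintro ⟨h1, h2⟩
  rcases hq with hq | hq
  · exact (hq.trans_le h1).false
  · exact (h2.trans_le hq).false

theorem admissible_insert_pos (hS : ∀ x ∈ S, k < x.idx) :
    Admissible (insert (Letter.pos k) S) ↔ Admissible S := by
  constructor
  · intro h c hp hb
    have := h c (Finset.mem_insert_of_mem hp) (Finset.mem_insert_of_mem hb)
    rwa [filter_window_insert (Or.inl (Letter.pos_lt_of_lt_idx (hS _ hp)))] at this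
  · intro h c hp hb
    have hb' : Letter.bar c ∈ S := by simpa using hb
    have hck : k < c := hS _ hb'
    have hp' : Letter.pos c ∈ S := by simpa [hck.ne'] using hp
    rw [filter_window_insert (Or.inl (Letter.pos_lt_of_lt_idx (hS _ hp')))]
    exact h c hp' hb'

theorem admissible_insert_bar (hS : ∀ x ∈ S, k < x.idx) :
    Admissible (insert (Letter.bar k) S) ↔ Admissible S := by
  constructor
  · intro h c hp hb
    have := h c (Finset.mem_insert_of_mem hp) (Finset.mem_insert_of_mem hb)
    rwa [filter_window_insert (Or.inr (Letter.lt_bar_of_lt_idx (hS _ hb)).le)] at this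
  · intro h c hp hb
    have hp' : Letter.pos c ∈ S := by simpa using hp
    have hck : k < c := hS _ hp'
    have hb' : Letter.bar c ∈ S := by simpa [hck.ne'] using hb
    rw [filter_window_insert (Or.inr (Letter.lt_bar_of_lt_idx (hS _ hb')).le)]
    exact h c hp' hb'

theorem admissible_insert_pos_bar (hS : ∀ x ∈ S, k < x.idx) :
    Admissible (insert (Letter.pos k) (insert (Letter.bar k) S)) ↔
      Admissible S ∧ S.card + 1 ≤ n - ((k : ℕ) + 1) := by
  have hpS : Letter.pos k ∉ S := fun h => (hS _ h).false
  have hwin : ((insert (Letter.pos k) (insert (Letter.bar k) S)).filter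
      fun y => Letter.pos k ≤ y ∧ y < Letter.bar k) = insert (Letter.pos k) S := by
    rw [Finset.filter_insert, if_pos ⟨le_rfl, Letter.pos_lt_bar _ _⟩,
      filter_window_insert (Or.inr le_rfl), Finset.filter_true_of_mem]
    exact fun x hx => ⟨(Letter.pos_lt_of_lt_idx (hS _ hx)).le, Letter.lt_bar_of_lt_idx (hS _ hx)⟩
  have hwin' : ∀ c, k < c → ((insert (Letter.pos k) (insert (Letter.bar k) S)).filter
      fun y => Letter.pos c ≤ y ∧ y < Letter.bar c)
        = S.filter fun y => Letter.pos c ≤ y ∧ y < Letter.bar c := by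
    intro c hc
    rw [filter_window_insert (Or.inl (Letter.pos_lt_of_lt_idx hc)),
      filter_window_insert (Or.inr (Letter.lt_bar_of_lt_idx (x := Letter.bar c) hc).le)]
  constructor
  · intro h
    refine ⟨fun c hp hb => ?_, ?_⟩
    · rw [← hwin' c (hS _ hp)]
      exact h c (by simp [hp]) (by simp [hb])
    · have := h k (by simp) (by simp)
      rwa [hwin, Finset.card_insert_of_notMem hpS] at this
  · rintro ⟨h, hcard⟩ c hp hb
    rcases eq_or_ne c k with rfl | hck
    · rwa [hwin, Finset.card_insert_of_notMem hpS]
    · have hp' : Letter.pos c ∈ S := by simpa [hck] using hp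
      have hb' : Letter.bar c ∈ S := by simpa [hck] using hb
      rw [hwin' c (hS _ hp')]
      exact h c hp' hb'

end Admissible

/-- The last `N` unbarred letters together with their barred counterparts. -/
def innerLetters (n N : ℕ) : Finset (Letter n) := Finset.univ.filter fun x => n ≤ x.idx + N

theorem innerLetters_self (n : ℕ) : innerLetters n n = Finset.univ := by
  simp [innerLetters]

theorem outerIdx_lt_idx {n N : ℕ} (hN : N < n) {x : Letter n} (hx : x ∈ innerLetters n N) :
    outerIdx hN < x.idx := by
  simp only [innerLetters, Finset.mem_filter, Finset.mem_univ, true_and] at hx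
  rw [Fin.lt_def, outerIdx]
  simp only
  omega

theorem innerLetters_succ {n N : ℕ} (hN : N < n) : innerLetters n (N + 1)
    = insert (Letter.pos (outerIdx hN)) (insert (Letter.bar (outerIdx hN)) (innerLetters n N)) := by
  ext x
  rcases x with i | i <;>
  · simp only [innerLetters, Finset.mem_insert, Finset.mem_filter, Finset.mem_univ, true_and]
    simp only [Letter.idx, outerIdx, Letter.pos.injEq, Letter.bar.injEq, Fin.ext_iff, reduceCtorEq,
      false_or]
    omega

open Classical in
/-- The sum of the weights of the admissible columns of length `d` with entries among the last `N`
letters and their bars. -/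
def colSum (n : ℕ) (a : ℂ) (N : ℕ) (d s : ℤ) : ZRing n :=
  ∑ S ∈ (innerLetters n N).powerset,
    if (S.card : ℤ) = d ∧ Admissible S then colWeight (fun x t => z x (a - 2 * (t : ℂ))) S s else 0

/-- The recursion of `nestCoeff`, except that the extra rule cuts off the last summand, which stems
from the columns that contain both `n-N` and its bar: these two are the first and the last entry, at
distance `d - 1`. -/
theorem colSum_succ {n N : ℕ} (hN : N < n) (a : ℂ) (d s : ℤ) :
    colSum n a (N + 1) d s = colSum n a N d s + outerPos n a N s * colSum n a N (d - 1) (s + 1)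
      + colSum n a N (d - 1) s * outerBar n a N (s + d - 1)
      + if d ≤ N + 1 then
          outerPos n a N s * colSum n a N (d - 2) (s + 1) * outerBar n a N (s + d - 1) else 0 := by
  classical
  have hpN : Letter.pos (outerIdx hN) ∉ innerLetters n N := fun h => (outerIdx_lt_idx hN h).false
  have hbN : Letter.bar (outerIdx hN) ∉ innerLetters n N := fun h => (outerIdx_lt_idx hN h).false
  rw [colSum, innerLetters_succ hN, Finset.sum_powerset_insert (by simp [hpN]),
    Finset.sum_powerset_insert hbN, Finset.sum_powerset_insert hbN, outerPos_of_lt hN,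
    outerBar_of_lt hN]
  have key : ∀ S ∈ (innerLetters n N).powerset, (∀ x ∈ S, outerIdx hN < x.idx) ∧
      Letter.pos (outerIdx hN) ∉ S ∧ Letter.bar (outerIdx hN) ∉ S := fun S hS => by
    rw [Finset.mem_powerset] at hS
    exact ⟨fun x hx => outerIdx_lt_idx hN (hS hx), fun h => hpN (hS h), fun h => hbN (hS h)⟩
  rw [add_assoc, add_assoc, add_assoc, add_left_comm (∑ t ∈ _, _) (∑ t ∈ _, _) (∑ t ∈ _, _)]
  congr 1
  congr 1
  · rw [colSum, Finset.mul_sum]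
    refine Finset.sum_congr rfl fun S hS => ?_
    obtain ⟨hS, hp, hb⟩ := key S hS
    rw [Finset.card_insert_of_notMem hp, admissible_insert_pos hS,
      colWeight_insert_min _ fun y hy => Letter.pos_lt_of_lt_idx (hS y hy), mul_ite, mul_zero]
    refine if_congr (and_congr_left' ?_) rfl rfl
    push_cast
    omega
  congr 1
  · rw [colSum, Finset.sum_mul]
    refine Finset.sum_congr rfl fun S hS => ?_
    obtain ⟨hS, hp, hb⟩ := key S hS
    rw [Finset.card_insert_of_notMem hb, admissible_insert_bar hS,
      colWeight_insert_max _ fun y hy => Letter.lt_bar_of_lt_idx (hS y hy), ite_mul, zero_mul]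
    rw [Nat.cast_succ]
    by_cases hd : (S.card : ℤ) = d - 1 ∧ Admissible S
    · rw [if_pos hd, if_pos ⟨by omega, hd.2⟩, hd.1, add_sub_assoc]
    · rw [if_neg hd, if_neg fun h => hd ⟨by omega, h.2⟩]
  · have hidx : n - ((outerIdx hN : ℕ) + 1) = N := by
      simp only [outerIdx]
      omega
    have hcond : ∀ S ∈ (innerLetters n N).powerset,
        (((insert (Letter.pos (outerIdx hN)) (insert (Letter.bar (outerIdx hN)) S)).card : ℤ) = d ∧
          Admissible (insert (Letter.pos (outerIdx hN)) (insert (Letter.bar (outerIdx hN)) S))) ↔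
        d ≤ N + 1 ∧ ((S.card : ℤ) = d - 2 ∧ Admissible S) := by
      intro S hS
      obtain ⟨hS, hp, hb⟩ := key S hS
      rw [Finset.card_insert_of_notMem (by simp [hp]), Finset.card_insert_of_notMem hb,
        admissible_insert_pos_bar hS, hidx]
      push_cast
      constructor
      · rintro ⟨h1, h2, h3⟩
        exact ⟨by omega, by omega, h2⟩
      · rintro ⟨h1, h2, h3⟩
        exact ⟨by omega, h3, by omega⟩
    split_ifs with hd
    · rw [colSum, Finset.mul_sum, Finset.sum_mul]
      refine Finset.sum_congr rfl fun S hS => ?_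
      rw [if_congr (hcond S hS) rfl rfl]
      obtain ⟨hS, hp, hb⟩ := key S hS
      by_cases hc : (S.card : ℤ) = d - 2 ∧ Admissible S
      · rw [if_pos ⟨hd, hc⟩, if_pos hc, colWeight_insert_min, colWeight_insert_max, hc.1, mul_assoc,
          show s + 1 + (d - 2) = s + d - 1 by ring]
        · exact fun y hy => Letter.lt_bar_of_lt_idx (hS y hy)
        · intro y hy
          rcases Finset.mem_insert.mp hy with rfl | hy
          · exact Letter.pos_lt_bar _ _
          · exact Letter.pos_lt_of_lt_idx (hS y hy)
      · rw [if_neg hc, if_neg fun h => hc h.2, mul_zero, zero_mul]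
    · refine Finset.sum_eq_zero fun S hS => ?_
      rw [if_congr (hcond S hS) rfl rfl, if_neg fun h => hd h.1]

/-- Passing from `N` to `N + 1`, the two recursions agree in degrees up to `N + 1`. In degree
`N + 2` both sides vanish: the left side because no admissible column is that long, the right side
by antisymmetry. -/
theorem colSum_eq_nestCoeff {n : ℕ} (a : ℂ) {N : ℕ} (hN : N ≤ n) :
    (∀ d s : ℤ, d ≤ N + 1 → colSum n a N d s = nestCoeff (outerPos n a) (outerBar n a) N d s) ∧
    ∀ d s : ℤ, N + 1 ≤ d → colSum n a N d s = 0 := by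
  induction N with
  | zero =>
    have h0 : innerLetters n 0 = ∅ := by
      ext x
      simp [innerLetters]
    have hadm : Admissible (∅ : Finset (Letter n)) := by simp [Admissible]
    simp only [colSum, h0, Finset.powerset_empty, Finset.sum_singleton, Finset.card_empty, hadm,
      and_true, colWeight, Finset.prod_empty, nestCoeff, Nat.cast_zero, zero_add]
    refine ⟨fun d s hd => ?_, fun d s hd => if_neg (by omega)⟩
    simp only [eq_comm (a := (0 : ℤ)), show d ≠ 2 by omega, if_false]
  | succ N ih =>
    obtain ⟨ih1, ih2⟩ := ih (by omega)
    have hzero : ∀ d s : ℤ, (N + 1 : ℕ) + 1 ≤ d → colSum n a (N + 1) d s = 0 := by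
      intro d s hd
      push_cast at hd
      rw [colSum_succ (by omega), ih2 _ _ (by omega), ih2 _ _ (by omega), ih2 _ _ (by omega),
        if_neg (by omega)]
      simp
    refine ⟨fun d s hd => ?_, hzero⟩
    rcases hd.eq_or_lt with rfl | hd
    · rw [hzero _ _ le_rfl,
        (nestCoeff_antisymm (fun N hN s => outerPos_mul_outerBar hN a s) hN).1]
    · push_cast at hd
      rw [colSum_succ (by omega), nestCoeff, if_pos (by omega), ih1 _ _ (by omega),
        ih1 _ _ (by omega), ih1 _ _ (by omega), ih1 _ _ (by omega)]

end TypeC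

/-! ### Tableaux of one column and the determinants -/

namespace TypeC

section StrictMono

theorem colWeight_image {α R : Type*} [LinearOrder α] [DecidableEq α] [CommRing R]
    (w : α → ℤ → R) {k : ℕ}
    {t : Fin k → α} (ht : StrictMono t) (s : ℤ) :
    colWeight w (Finset.univ.image t) s = ∏ i, w (t i) (s + (i : ℕ)) := by
  rw [colWeight, Finset.prod_image ht.injective.injOn]
  refine Finset.prod_congr rfl fun i _ => ?_
  rw [Finset.filter_image, Finset.card_image_of_injective _ ht.injective]
  simp only [ht.lt_iff_lt]
  rw [Finset.filter_gt_eq_Iio, Fin.card_Iio]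

theorem admissible_image {n k : ℕ} {t : Fin k → Letter n} (ht : StrictMono t) :
    Admissible (Finset.univ.image t) ↔ ∀ (i j : Fin k) (c : Fin n), t i = Letter.pos c →
      t j = Letter.bar c → (j : ℕ) - i ≤ n - ((c : ℕ) + 1) := by
  have hwin : ∀ (i j : Fin k), ((Finset.univ.image t).filter fun y => t i ≤ y ∧ y < t j).card
      = (j : ℕ) - i := by
    intro i j
    rw [Finset.filter_image, Finset.card_image_of_injective _ ht.injective]
    simp only [ht.lt_iff_lt, ht.le_iff_le]
    rw [← Fin.card_Ico]
    congr 1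
    ext x
    simp
  constructor
  · intro h i j c hi hj
    rw [← hwin, hi, hj]
    exact h c (by simp [← hi]) (by simp [← hj])
  · intro h c hp hb
    obtain ⟨i, -, hi⟩ := Finset.mem_image.mp hp
    obtain ⟨j, -, hj⟩ := Finset.mem_image.mp hb
    rw [← hi, ← hj, hwin]
    exact h i j c hi hj

end StrictMono

section Column

variable {n : ℕ} {lam mu : YoungDiagram}

theorem rowLen_eq_ite {lam : YoungDiagram} (h : lam.rowLen 0 ≤ 1) (i : ℕ) :
    lam.rowLen i = if i < len lam then 1 else 0 := by
  have h1 : lam.rowLen i ≤ 1 := (lam.rowLen_anti 0 i (Nat.zero_le i)).trans h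
  have h2 : 0 < lam.rowLen i ↔ i < len lam := by
    rw [len, ← YoungDiagram.mem_iff_lt_colLen, YoungDiagram.mem_iff_lt_rowLen]
  split_ifs <;> omega

theorem colLen_eq_zero {lam : YoungDiagram} (h : lam.rowLen 0 ≤ 1) {j : ℕ} (hj : 1 ≤ j) :
    lam.colLen j = 0 := by
  by_contra hne
  have : (0, j) ∈ lam := YoungDiagram.mem_iff_lt_colLen.mpr (Nat.pos_of_ne_zero hne)
  rw [YoungDiagram.mem_iff_lt_rowLen] at this
  omega

theorem rowLen_zero_mono (hsub : mu ≤ lam) : mu.rowLen 0 ≤ lam.rowLen 0 := by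
  by_contra h
  have h1 : (0, lam.rowLen 0) ∈ lam :=
    hsub (YoungDiagram.mem_iff_lt_rowLen.mpr (not_le.mp h))
  exact (YoungDiagram.mem_iff_lt_rowLen.mp h1).false

theorem len_mono (hsub : mu ≤ lam) : len mu ≤ len lam := by
  by_contra h
  have h1 : (len lam, 0) ∈ lam :=
    hsub (YoungDiagram.mem_iff_lt_colLen.mpr (not_le.mp h))
  exact (YoungDiagram.mem_iff_lt_colLen.mp h1).false

theorem mem_skewCells_iff (hcol : lam.rowLen 0 ≤ 1) {c : ℕ × ℕ} :
    c ∈ skewCells lam mu ↔ c.2 = 0 ∧ len mu ≤ c.1 ∧ c.1 < len lam := by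
  obtain ⟨i, j⟩ := c
  rw [Finset.mem_sdiff, YoungDiagram.mem_cells, YoungDiagram.mem_cells,
    YoungDiagram.mem_iff_lt_colLen, YoungDiagram.mem_iff_lt_colLen]
  rcases Nat.eq_zero_or_pos j with rfl | hj
  · simp [len, and_comm]
  · simp [colLen_eq_zero hcol hj, hj.ne']

/-- The boxes of a one-column skew diagram, numbered from top to bottom. -/
def columnEquiv (hcol : lam.rowLen 0 ≤ 1) :
    Fin (len lam - len mu) ≃ {c : ℕ × ℕ // c ∈ skewCells lam mu} where
  toFun i := ⟨(len mu + i, 0), (mem_skewCells_iff hcol).mpr ⟨rfl, by simp, by simp; omega⟩⟩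
  invFun c := ⟨c.1.1 - len mu, by
    have := (mem_skewCells_iff hcol).mp c.2
    omega⟩
  left_inv i := by simp
  right_inv c := by
    obtain ⟨⟨i, j⟩, hc⟩ := c
    obtain ⟨h1, h2, -⟩ := (mem_skewCells_iff hcol).mp hc
    simp only at h1 h2
    simp [h1, h2]

/-- In one column the horizontal rule is empty, and the vertical rule says that the entries increase
strictly, as its exceptions need a box in a neighbouring column. -/
theorem mem_Tab_iff (hcol : lam.rowLen 0 ≤ 1) (T : Tableau n lam mu) :
    T ∈ Tab n lam mu ↔ StrictMono (T ∘ columnEquiv hcol) ∧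
      Admissible (Finset.univ.image (T ∘ columnEquiv hcol)) := by
  have hH : HRule T := by
    refine ⟨fun i j h0 h1 => ?_, fun i j h0 h1 h2 => ?_⟩ <;>
    · have := ((mem_skewCells_iff hcol).mp h1).1
      simp at this
  have hV : VRule T ↔ StrictMono (T ∘ columnEquiv hcol) := by
    constructor
    · intro hV
      -- Strict increase from one box to the next propagates to all pairs of boxes.
      have hstep : ∀ (m i : ℕ) (hm : i + m + 1 < len lam - len mu),
          (T ∘ columnEquiv hcol) ⟨i, by omega⟩ < (T ∘ columnEquiv hcol) ⟨i + m + 1, hm⟩ := by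
        have hnext : ∀ (i : ℕ) (hi : i + 1 < len lam - len mu),
            (T ∘ columnEquiv hcol) ⟨i, by omega⟩ < (T ∘ columnEquiv hcol) ⟨i + 1, hi⟩ := by
          intro i hi
          rcases hV (len mu + i) 0 (columnEquiv hcol ⟨i, by omega⟩).2
            (columnEquiv hcol ⟨i + 1, hi⟩).2 with hlt | ⟨-, -, j, hj, -⟩ | ⟨-, -, hright, -⟩
          · exact hlt
          · omega
          · simpa using ((mem_skewCells_iff hcol).mp hright).1
        intro m
        induction m with
        | zero => exact hnext
        | succ m ih => exact fun i hm => (ih i (by omega)).trans (hnext (i + m + 1) hm)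
      intro i j hij
      obtain ⟨m, hm⟩ := Nat.exists_eq_add_of_lt (show (i : ℕ) < j from hij)
      convert hstep m i (by omega) using 2
      exact Fin.ext hm
    · intro hmono i j h0 h1
      left
      have hM := ((mem_skewCells_iff hcol).mp h0).2.1
      have := @hmono ((columnEquiv hcol).symm ⟨_, h0⟩) ((columnEquiv hcol).symm ⟨_, h1⟩) (by
        rw [Fin.lt_def]
        simp only [columnEquiv, Equiv.coe_fn_symm_mk] at hM ⊢
        omega)
      simpa using this
  simp only [Tab, Finset.mem_filter, Finset.mem_univ, true_and, hH, hV]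
  refine and_congr_right fun hmono => ?_
  rw [admissible_image hmono]
  constructor
  · intro hE i j c hi hj
    by_cases hij : j ≤ i
    · have : (j : ℕ) ≤ i := hij
      omega
    have hij' : (i : ℕ) < j := not_le.mp hij
    have := hE (len mu + i) 0 (j - i + 1) c (by omega) (columnEquiv hcol i).2
      (by
        convert (columnEquiv (mu := mu) hcol j).2 using 1
        simp [columnEquiv]
        omega) hi
      (by
        rw [← hj]
        simp [columnEquiv]
        congr 3
        omega)
    simpa using this
  · intro h i j l c hl h0 h1 hi hj
    have hi' := h ((columnEquiv hcol).symm ⟨_, h0⟩) ((columnEquiv hcol).symm ⟨_, h1⟩) c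
      (by simpa using hi) (by simpa using hj)
    have := ((mem_skewCells_iff hcol).mp h0).2.1
    simp only [columnEquiv, Equiv.coe_fn_symm_mk] at hi' this
    omega

/-- A strictly increasing column is determined by its set of entries. -/
theorem sum_Tab_eq_colSum (hcol : lam.rowLen 0 ≤ 1) (a : ℂ) :
    ∑ T ∈ Tab n lam mu, weight T a = colSum n a n ((len lam - len mu : ℕ) : ℤ) (len mu) := by
  classical
  rw [colSum, innerLetters_self, Finset.powerset_univ, ← Finset.sum_filter]
  refine Finset.sum_bij (fun T _ => Finset.univ.image (T ∘ columnEquiv hcol)) ?_ ?_ ?_ ?_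
  · intro T hT
    obtain ⟨hmono, hadm⟩ := (mem_Tab_iff hcol T).mp hT
    simp only [Finset.mem_filter, Finset.mem_univ, true_and, Nat.cast_inj]
    refine ⟨?_, hadm⟩
    rw [Finset.card_image_of_injective _ hmono.injective, Finset.card_univ, Fintype.card_fin]
  · intro T hT T' hT' h
    have hmono := ((mem_Tab_iff hcol T).mp hT).1
    have hmono' := ((mem_Tab_iff hcol T').mp hT').1
    have hr : Set.range (T ∘ columnEquiv hcol) = Set.range (T' ∘ columnEquiv hcol) := by
      simpa only [Finset.coe_image, Finset.coe_univ, Set.image_univ] using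
        congrArg (fun S : Finset (Letter n) => (S : Set (Letter n))) h
    have := (hmono.range_inj hmono').mp hr
    exact (columnEquiv hcol).surjective.injective_comp_right this
  · intro S hS
    simp only [Finset.mem_filter, Finset.mem_univ, true_and, Nat.cast_inj] at hS
    have himg : Finset.univ.image ((S.orderEmbOfFin hS.1 ∘ (columnEquiv hcol).symm)
        ∘ columnEquiv hcol) = S := by
      rw [Function.comp_assoc, Equiv.symm_comp_self, Function.comp_id]
      convert Finset.image_orderEmbOfFin_univ S hS.1
    refine ⟨S.orderEmbOfFin hS.1 ∘ (columnEquiv hcol).symm, ?_, himg⟩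
    rw [mem_Tab_iff hcol, himg]
    refine ⟨?_, hS.2⟩
    rw [Function.comp_assoc, Equiv.symm_comp_self, Function.comp_id]
    exact (S.orderEmbOfFin hS.1).strictMono
  · intro T hT
    rw [colWeight_image _ ((mem_Tab_iff hcol T).mp hT).1, weight,
      ← (columnEquiv hcol).prod_comp]
    refine Finset.prod_congr rfl fun i _ => ?_
    simp only [Function.comp_apply]
    congr 1
    simp only [columnEquiv, Equiv.coe_fn_mk]
    push_cast
    ring

end Column

theorem nestCoeff_zero_deg {R : Type*} [CommRing R] (u v : ℕ → ℤ → R) (N : ℕ) (s : ℤ) :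
    nestCoeff u v N 0 s = 1 := by
  induction N with
  | zero => simp [nestCoeff]
  | succ N ih =>
    rw [nestCoeff, ih, nestCoeff_of_neg u v N _ (by norm_num),
      nestCoeff_of_neg u v N _ (by norm_num), nestCoeff_of_neg u v N _ (by norm_num)]
    simp

theorem e_zero {n : ℕ} (hn : 1 ≤ n) (b : ℂ) : e hn 0 b = 1 := by
  have := e_eq_nestCoeff hn b 0 0
  rwa [nestCoeff_zero_deg, Int.cast_zero, mul_zero, sub_zero] at this

theorem h_zero {n : ℕ} (hn : 1 ≤ n) (b : ℂ) : h hn 0 b = 1 := by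
  have := sum_antidiagonal_h_mul_e hn b 0 0
  simpa [e_zero] using this

theorem e_of_neg {n : ℕ} (hn : 1 ≤ n) {d : ℤ} (hd : d < 0) (b : ℂ) : e hn d b = 0 :=
  if_neg (not_le.mpr hd)

theorem h_of_neg {n : ℕ} (hn : 1 ≤ n) {d : ℤ} (hd : d < 0) (b : ℂ) : h hn d b = 0 :=
  if_neg (not_le.mpr hd)

theorem detE_column {n : ℕ} (hn : 1 ≤ n) {lam mu : YoungDiagram} (hsub : mu ≤ lam)
    (hcol : lam.rowLen 0 ≤ 1) {l : ℕ} (hl : 1 ≤ l) (a : ℂ) :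
    detE hn lam mu l a = e hn ((len lam - len mu : ℕ) : ℤ) (a - 2 * len mu) := by
  obtain ⟨r, rfl⟩ := Nat.exists_eq_add_of_le hl
  have hcol' := (rowLen_zero_mono hsub).trans hcol
  rw [detE, det_trim_last (fun i j => e hn ((lam.colLen i : ℤ) - mu.colLen j - (i : ℕ) + (j : ℕ))
      (a - 2 * ((mu.colLen j : ℂ) - ((j : ℕ) + 1) + 1))), Matrix.det_fin_one]
  · have := len_mono hsub
    rw [Nat.cast_sub this]
    simp [len]
  · intro i j hi hij
    rw [colLen_eq_zero hcol hi]
    exact e_of_neg hn (by push_cast; omega) _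
  · intro i hi
    rw [colLen_eq_zero hcol hi, colLen_eq_zero hcol' hi]
    convert e_zero hn _ using 2
    simp

theorem detH_column {n : ℕ} (hn : 1 ≤ n) {lam mu : YoungDiagram} (hsub : mu ≤ lam)
    (hcol : lam.rowLen 0 ≤ 1) {l : ℕ} (hl : len lam ≤ l) (a : ℂ) :
    detH hn lam mu l a = e hn ((len lam - len mu : ℕ) : ℤ) (a - 2 * len mu) := by
  obtain ⟨r, rfl⟩ := Nat.exists_eq_add_of_le hl
  have hcol' := (rowLen_zero_mono hsub).trans hcol
  have hlen := len_mono hsub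
  obtain ⟨k, hk⟩ := Nat.exists_eq_add_of_le hlen
  let A : ℕ → ℕ → ZRing n := fun i j => h hn ((lam.rowLen i : ℤ) - mu.rowLen j - (i : ℕ) + (j : ℕ))
      (a + 2 * ((lam.rowLen i : ℂ) - ((i : ℕ) + 1)))
  have h1 : detH hn lam mu (len lam + r) a = (Matrix.of fun i j : Fin (len lam) => A i j).det := by
    refine det_trim_last A _ _ (fun i j hi hij => ?_) (fun i hi => ?_)
    · simp only [A]
      rw [rowLen_eq_ite hcol i, if_neg (by omega)]
      exact h_of_neg hn (by push_cast; omega) _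
    · simp only [A]
      rw [rowLen_eq_ite hcol i, rowLen_eq_ite hcol' i, if_neg (by omega), if_neg (by omega)]
      convert h_zero hn _ using 2
      simp
  have h2 : (Matrix.of fun i j : Fin (len mu + k) => A i j).det
      = (Matrix.of fun i j : Fin k => A (len mu + i) (len mu + j)).det := by
    refine det_trim_first A _ _ (fun i j hj hij => ?_) (fun i hi => ?_)
    · simp only [A]
      rw [rowLen_eq_ite hcol i, rowLen_eq_ite hcol' j, if_pos hj]
      refine h_of_neg hn ?_ _
      split_ifs <;> (push_cast; omega)
    · simp only [A]
      rw [rowLen_eq_ite hcol i, rowLen_eq_ite hcol' i, if_pos hi, if_pos (by omega)]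
      convert h_zero hn _ using 2
      simp
  rw [h1, hk, h2, Nat.add_sub_cancel_left]
  have h3 := det_hessenberg_eq (g := fun d s => h hn d (a - 2 * (s : ℂ)))
    (f := fun d s => e hn d (a - 2 * (s : ℂ))) (fun d s hd => h_of_neg hn hd _)
    (fun d s hd => e_of_neg hn hd _) (fun s => h_zero hn _)
    (fun m s => sum_antidiagonal_h_mul_e hn a m s) k (len mu)
  simp only [Int.cast_natCast] at h3
  rw [← h3]
  congr 2
  ext i j
  simp only [A]
  rw [rowLen_eq_ite hcol, rowLen_eq_ite hcol', if_pos (by omega), if_neg (by omega)]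
  congr 1
  · push_cast
    ring
  · push_cast
    ring

theorem e_eq_sum_Tab {n : ℕ} (hn : 1 ≤ n) {lam mu : YoungDiagram}
    (hcol : lam.rowLen 0 ≤ 1) (hlen : len lam ≤ n + 1) (a : ℂ) :
    e hn ((len lam - len mu : ℕ) : ℤ) (a - 2 * len mu) = ∑ T ∈ Tab n lam mu, weight T a := by
  rw [sum_Tab_eq_colSum hcol, (colSum_eq_nestCoeff a le_rfl).1 _ _ (by omega),
    ← e_eq_nestCoeff hn, Int.cast_natCast]

end TypeC

end

/-- One-column tableaux formula in type `C_n`: the Jacobi-Trudi determinant, in either of its two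
forms and for every admissible size, is the sum of the weights of the tableaux in
`Tab(C_n, λ/μ)`. -/
theorem mainTheorem8 (n : ℕ) (hn : 1 ≤ n) (lam mu : YoungDiagram) (hsub : mu ≤ lam)
    (hcol : TypeC.len lam.transpose = 1) (hlen : TypeC.len lam ≤ n + 1) (a : ℂ) :
    (∀ l : ℕ, TypeC.len lam ≤ l → TypeC.len mu ≤ l →
      TypeC.detH hn lam mu l a = ∑ T ∈ TypeC.Tab n lam mu, TypeC.weight T a) ∧
    (∀ l' : ℕ, TypeC.len lam.transpose ≤ l' → TypeC.len mu.transpose ≤ l' →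
      TypeC.detE hn lam mu l' a = ∑ T ∈ TypeC.Tab n lam mu, TypeC.weight T a) := by
  have hrow : lam.rowLen 0 ≤ 1 := by
    rw [TypeC.len, YoungDiagram.colLen_transpose] at hcol
    exact hcol.le
  refine ⟨fun l hl _ => ?_, fun l' hl' _ => ?_⟩
  · rw [TypeC.detH_column hn hsub hrow hl, TypeC.e_eq_sum_Tab hn hrow hlen]
  · rw [TypeC.detE_column hn hsub hrow (hcol ▸ hl'), TypeC.e_eq_sum_Tab hn hrow hlen]
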